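/- Let $\omega=\pi/4$ and let $\Omega$ be the square $\Omega_0=(-1,1)^2$ rotated counterclockwise by $\omega$ around the origin. For $n\ge 1$ divide $\Omega_0$ into $n\times n$ equal squares, cut each of them into two triangles by its diagonal of direction $(1,1)$, and rotate this mesh by $\omega$. Let $V^{(n)}$ be the space of continuous functions on $\overline\Omega$ that are affine on each triangle of the rotated mesh and vanish on $\partial\Omega$. For $N\ge 1$ let $V_H=V^{(N)}$ be the coarse space and $V_h=V^{(2N)}$ the fine space, so that $h=H/2$. For $\epsilon>0$ let $$a(u,v)=\int_\Omega(\partial_xu\,\partial_xv+\epsilon\,\partial_yu\,\partial_yv)\,dx\,dy,\qquad \|v\|_a^2=a(v,v).$$ Let $V_1,\dots,V_J\subset V_h$ be the one-dimensional spaces spanned by the nodal basis functions of the interior vertices of the fine mesh, numbered in any order; let $P_i$ and $P_H$ be the $a$-orthogonal projections onto $V_i$ and $V_H$. Let $$\|v\|_*^2=\inf\Big\{\sum_i\|v_i\|_a^2:\ v_i\in V_i,\ \sum_iv_i=v\Big\},$$ and let $\Pi_*$ be the projection onto $V_H$ that is orthogonal in the inner product $(\cdot,\cdot)_*$ belonging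 to this norm. The error propagation operator of the two-level method with point-wise Gauss--Seidel smoother is $$E_{TL}=(I-T)(I-P_H),\qquad I-T=(I-P_J)\cdots(I-P_1).$$ Then for every $\epsilon_0>0$ there is a constant $C>0$, depending only on $\epsilon_0$, such that for all $N\ge 1$, all $0<\epsilon\le\epsilon_0$ and every ordering of the interior vertices, $$K=\sup_{0\ne v\in V_h}\frac{\|(I-\Pi_*)v\|_*^2}{\|v\|_a^2}\le C\qquad\text{and}\qquad \|E_{TL}\|_a^2=\sup_{0\ne v\in V_h}\frac{\|E_{TL}v\|_a^2}{\|v\|_a^2}\le 1-\frac1C .$$ In particular, $C$ is independent of $\epsilon\in(0,\epsilon_0]$ and of $h$. -/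

import Mathlib

open MeasureTheory
open scoped BigOperators

noncomputable section

namespace AnisoFEM

/-- Scalar functions on the plane. A finite element function on a domain is identified with its
extension by zero to the whole plane. -/
abbrev Fun : Type := ℝ × ℝ → ℝ

/-- Counterclockwise rotation of the plane around the origin by the angle `ω`. -/
def rot (ω : ℝ) (p : ℝ × ℝ) : ℝ × ℝ :=
  (Real.cos ω * p.1 - Real.sin ω * p.2, Real.sin ω * p.1 + Real.cos ω * p.2)

/-- The computational domain: the square `(-1,1)²` rotated by `ω`. -/
def domain (ω : ℝ) : Set (ℝ × ℝ) :=
  rot ω '' (Set.Ioo (-1 : ℝ) 1 ×ˢ Set.Ioo (-1 : ℝ) 1)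

/-- The vertex with indices `p = (i,j)`, `0 ≤ i, j ≤ n`, of the rotated `n × n` grid. -/
def node (ω : ℝ) (n : ℕ) (p : ℕ × ℕ) : ℝ × ℝ :=
  rot ω (-1 + 2 * (p.1 : ℝ) / (n : ℝ), -1 + 2 * (p.2 : ℝ) / (n : ℝ))

/-- The (closed) triangles of the mesh: each of the `n × n` squares is cut into two triangles by
its diagonal from the lower left to the upper right corner (before the rotation). -/
def triangles (ω : ℝ) (n : ℕ) : Set (Set (ℝ × ℝ)) :=
  {T | ∃ i j : ℕ, i < n ∧ j < n ∧
    (T = convexHull ℝ {node ω n (i, j), node ω n (i + 1, j), node ω n (i + 1, j + 1)} ∨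
     T = convexHull ℝ {node ω n (i, j), node ω n (i + 1, j + 1), node ω n (i, j + 1)})}

/-- The finite element space: continuous functions which are affine on every triangle of the
`n × n` mesh and satisfy the homogeneous Dirichlet condition (extended by zero). -/
def femSpace (ω : ℝ) (n : ℕ) : Submodule ℝ Fun where
  carrier := {v | Continuous v ∧ (∀ p, p ∉ domain ω → v p = 0) ∧
    ∀ T ∈ triangles ω n, ∃ a b c : ℝ, ∀ p ∈ T, v p = a * p.1 + b * p.2 + c}
  zero_mem' := ⟨continuous_const, fun _ _ => rfl, fun _ _ => ⟨0, 0, 0, fun p _ => by simp⟩⟩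
  add_mem' := by
    rintro u v ⟨hu, hu0, hu1⟩ ⟨hv, hv0, hv1⟩
    refine ⟨hu.add hv, fun p hp => by simp [hu0 p hp, hv0 p hp], fun T hT => ?_⟩
    obtain ⟨a, b, c, h⟩ := hu1 T hT
    obtain ⟨a', b', c', h'⟩ := hv1 T hT
    refine ⟨a + a', b + b', c + c', fun p hp => ?_⟩
    rw [Pi.add_apply, h p hp, h' p hp]
    ring
  smul_mem' := by
    rintro r v ⟨hv, hv0, hv1⟩
    refine ⟨hv.const_smul r, fun p hp => by simp [hv0 p hp], fun T hT => ?_⟩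
    obtain ⟨a, b, c, h⟩ := hv1 T hT
    refine ⟨r * a, r * b, r * c, fun p hp => ?_⟩
    rw [Pi.smul_apply, h p hp, smul_eq_mul]
    ring

/-- The indices of the interior vertices of the `n × n` grid. -/
def interiorNodes (n : ℕ) : Finset (ℕ × ℕ) :=
  Finset.Ioo 0 n ×ˢ Finset.Ioo 0 n

/-- The one-dimensional subspace spanned by the nodal basis function of the vertex `p`: the finite
element functions that vanish at all the other vertices. -/
def pointSpace (ω : ℝ) (n : ℕ) (p : ℕ × ℕ) : Submodule ℝ Fun where
  carrier := {v | v ∈ femSpace ω n ∧ ∀ q ∈ interiorNodes n, q ≠ p → v (node ω n q) = 0}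
  zero_mem' := ⟨Submodule.zero_mem _, fun _ _ _ => rfl⟩
  add_mem' := by
    rintro u v ⟨hu, hu0⟩ ⟨hv, hv0⟩
    exact ⟨Submodule.add_mem _ hu hv, fun q hq hqp => by simp [hu0 q hq hqp, hv0 q hq hqp]⟩
  smul_mem' := by
    rintro r v ⟨hv, hv0⟩
    exact ⟨Submodule.smul_mem _ r hv, fun q hq hqp => by simp [hv0 q hq hqp]⟩

/-- The partial derivative in `x` (for finite element functions it exists off the edges of the
mesh, hence almost everywhere, and is the weak derivative). -/
def dx (v : Fun) (p : ℝ × ℝ) : ℝ := fderiv ℝ v p (1, 0)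

/-- The partial derivative in `y`. -/
def dy (v : Fun) (p : ℝ × ℝ) : ℝ := fderiv ℝ v p (0, 1)

/-- The bilinear form `a(u,v) = ∫_Ω (∂ₓu ∂ₓv + ε ∂ᵧu ∂ᵧv)`. -/
def energyForm (ω ε : ℝ) (u v : Fun) : ℝ :=
  ∫ p in domain ω, (dx u p * dx v p + ε * (dy u p * dy v p))

/-- `orthProj B W v` is the element `p` of `W` with `B (v - p) q = 0` for all `q ∈ W`: the
`B`-orthogonal projection of `v` onto `W`. -/
def orthProj (B : Fun → Fun → ℝ) (W : Submodule ℝ Fun) (v : Fun) : Fun :=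
  Classical.epsilon (fun p : Fun => p ∈ W ∧ ∀ q ∈ W, B (v - p) q = 0)

/-- `‖v‖_*²`: the infimum of `∑ᵢ ‖vᵢ‖_a²` over the decompositions `v = ∑ᵢ vᵢ` into
functions `vᵢ` of the point-wise subspaces of the `n × n` mesh. -/
def starNormSq (ω ε : ℝ) (n : ℕ) (v : Fun) : ℝ :=
  sInf {s : ℝ | ∃ w : ℕ × ℕ → Fun, (∀ p ∈ interiorNodes n, w p ∈ pointSpace ω n p) ∧
    ∑ p ∈ interiorNodes n, w p = v ∧
    s = ∑ p ∈ interiorNodes n, energyForm ω ε (w p) (w p)}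

/-- The inner product `(u,v)_*` that induces the norm `‖·‖_*` (polarization). -/
def starInner (ω ε : ℝ) (n : ℕ) (u v : Fun) : ℝ :=
  (starNormSq ω ε n (u + v) - starNormSq ω ε n (u - v)) / 4

/-- `K = sup ‖(I - Π_*) v‖_*² / ‖v‖_a²` over the nonzero `v` of the fine space, where `Π_*` is the
`(·,·)_*`-orthogonal projection onto the coarse space. The coarse mesh has `N × N` squares and the
fine mesh, its regular refinement, has `2N × 2N`. -/
def stabilityK (ω ε : ℝ) (N : ℕ) : EReal :=
  ⨆ v ∈ {v : Fun | v ∈ femSpace ω (2 * N) ∧ v ≠ 0},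
    ((starNormSq ω ε (2 * N) (v - orthProj (starInner ω ε (2 * N)) (femSpace ω N) v) /
      energyForm ω ε v v : ℝ) : EReal)

/-- `order` lists every interior vertex of the `n × n` grid exactly once. -/
def IsNodeOrdering (n : ℕ) (order : List (ℕ × ℕ)) : Prop :=
  order.Nodup ∧ ∀ p, p ∈ order ↔ p ∈ interiorNodes n

/-- The error propagation `I - T = (I - P_J) ⋯ (I - P_1)` of one point-wise Gauss-Seidel sweep
that visits the vertices in the given order, where `P_k` is the `a`-orthogonal projection onto the
`k`-th point-wise subspace. -/
def gsSweep (ω ε : ℝ) (n : ℕ) (order : List (ℕ × ℕ)) (v : Fun) : Fun :=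
  order.foldl (fun u p => u - orthProj (energyForm ω ε) (pointSpace ω n p) u) v

/-- The two-level error propagation operator `E_TL = (I - T)(I - P_H)`, where `P_H` is the
`a`-orthogonal projection onto the coarse space. -/
def twoLevelError (ω ε : ℝ) (N : ℕ) (order : List (ℕ × ℕ)) (v : Fun) : Fun :=
  gsSweep ω ε (2 * N) order (v - orthProj (energyForm ω ε) (femSpace ω N) v)

/-- `‖E_TL‖_a²`, the square of the operator norm in the energy norm on the fine space. -/
def twoLevelErrorNormSq (ω ε : ℝ) (N : ℕ) (order : List (ℕ × ℕ)) : EReal :=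
  ⨆ v ∈ {v : Fun | v ∈ femSpace ω (2 * N) ∧ v ≠ 0},
    ((energyForm ω ε (twoLevelError ω ε N order v) (twoLevelError ω ε N order v) /
      energyForm ω ε v v : ℝ) : EReal)

end AnisoFEM

end

/-!
On the mesh rotated by `π/4` the diagonals of the cells are parallel to the `y`-axis, the direction
of weak coupling. In terms of the nodal values `f` of a finite element function the energy is the
mesh-independent sum over the cells `(i,j)` of
`(L² + U² + 2 ε D²) / 4`, where `L = 2 f(i+1,j) - f(i,j) - f(i+1,j+1)` and
`U = 2 f(i,j+1) - f(i,j) - f(i+1,j+1)` are scaled `x`-derivatives on the two halves of the cell and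
`D = f(i+1,j+1) - f(i,j)` is the scaled `y`-derivative (`energyForm_eq_gridEnergy`). Every nodal
basis function has the energy `3 + ε`, hence the star norm is `3 + ε` times the Euclidean norm of
the nodal values (`starNormSq_eq`).

If all `L` and `U` vanish on a patch, the function is affine in `y` there, and so nodal
interpolation on the coarse mesh reproduces it. Quantitatively, the interpolation error at a fine
vertex is half a second difference along an edge of the coarse mesh, and each of them is a
combination of the values of `L` and `U` in one block of `2 × 2` cells. Therefore the squared
Euclidean norm of the interpolation error is at most nine times the energy, uniformly in `ε`
(`exists_coarse_approximation`). The best approximation property of the star projection turns this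
into the bound of the stability constant (`stabilityK_le`).

For the two-level method let `v` be energy-orthogonal to the coarse space and let `e` be its
interpolation error, so that `a(v,v) = a(v,e)`. If `c` is the vector of the corrections made by the
Gauss-Seidel sweep, the energy drops by `(3 + ε) ∑ c²`, and `a(v,e)` is bounded by the form with
absolute values in the arguments `e` and `c` (`gsSweep_spec`). Since every vertex has boundedly many
neighbours, that form is bounded in the Euclidean norm (`gridEnergyAbs_self_le`), and Young's
inequality bounds `a(v,v)` by a multiple of `∑ c²`, that is, of the drop of the energy
(`energy_gsSweep_le`).
-/

namespace AnisoFEM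

/-! ### Grid coordinates and the triangles of the mesh -/

/-- The point of the plane with real grid coordinates `x`; `node` is its restriction to integer
coordinates. -/
noncomputable def gridPoint (ω : ℝ) (n : ℕ) (x : ℝ × ℝ) : ℝ × ℝ :=
  rot ω (-1 + 2 * x.1 / (n : ℝ), -1 + 2 * x.2 / (n : ℝ))

/-- The grid coordinates of a point of the plane: the rotated square becomes `[0,n]²` and the
vertices of the mesh become the integer points. -/
noncomputable def gridCoord (ω : ℝ) (n : ℕ) (p : ℝ × ℝ) : ℝ × ℝ :=
  ((n : ℝ) / 2 * (Real.cos ω * p.1 + Real.sin ω * p.2 + 1),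
    (n : ℝ) / 2 * (-(Real.sin ω * p.1) + Real.cos ω * p.2 + 1))

theorem node_eq_gridPoint (ω : ℝ) (n : ℕ) (q : ℕ × ℕ) :
    node ω n q = gridPoint ω n ((q.1 : ℝ), (q.2 : ℝ)) := rfl

theorem gridPoint_gridCoord (ω : ℝ) {n : ℕ} (hn : n ≠ 0) (p : ℝ × ℝ) :
    gridPoint ω n (gridCoord ω n p) = p := by
  have hn' : (n : ℝ) ≠ 0 := Nat.cast_ne_zero.mpr hn
  have h := Real.sin_sq_add_cos_sq ω
  ext
  · simp only [gridPoint, gridCoord, rot]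
    field_simp
    linear_combination p.1 * h
  · simp only [gridPoint, gridCoord, rot]
    field_simp
    linear_combination p.2 * h

theorem gridCoord_gridPoint (ω : ℝ) {n : ℕ} (hn : n ≠ 0) (x : ℝ × ℝ) :
    gridCoord ω n (gridPoint ω n x) = x := by
  have hn' : (n : ℝ) ≠ 0 := Nat.cast_ne_zero.mpr hn
  have h := Real.sin_sq_add_cos_sq ω
  ext
  · simp only [gridPoint, gridCoord, rot]
    field_simp
    linear_combination (2 * x.1 - n) * h
  · simp only [gridPoint, gridCoord, rot]
    field_simp
    linear_combination (2 * x.2 - n) * h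

theorem gridCoord_node (ω : ℝ) {n : ℕ} (hn : n ≠ 0) (q : ℕ × ℕ) :
    gridCoord ω n (node ω n q) = ((q.1 : ℝ), (q.2 : ℝ)) := by
  rw [node_eq_gridPoint, gridCoord_gridPoint ω hn]

theorem continuous_gridCoord (ω : ℝ) (n : ℕ) : Continuous (gridCoord ω n) := by
  unfold gridCoord
  fun_prop

theorem mem_domain_iff (ω : ℝ) {n : ℕ} (hn : n ≠ 0) (p : ℝ × ℝ) :
    p ∈ domain ω ↔ (0 < (gridCoord ω n p).1 ∧ (gridCoord ω n p).1 < n) ∧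
      0 < (gridCoord ω n p).2 ∧ (gridCoord ω n p).2 < n := by
  have hn' : (0 : ℝ) < n := Nat.cast_pos.mpr (Nat.pos_of_ne_zero hn)
  constructor
  · rintro ⟨⟨s, t⟩, ⟨⟨hs, hs'⟩, ht, ht'⟩, rfl⟩
    have hx : rot ω (s, t) = gridPoint ω n (n / 2 * (s + 1), n / 2 * (t + 1)) := by
      unfold gridPoint
      congr 1
      ext <;> simp <;> field_simp <;> ring
    rw [hx, gridCoord_gridPoint ω hn]
    simp only at hs hs' ht ht' ⊢
    refine ⟨⟨?_, ?_⟩, ?_, ?_⟩ <;> nlinarith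
  · rintro ⟨⟨hs, hs'⟩, ht, ht'⟩
    refine ⟨_, ?_, gridPoint_gridCoord ω hn p⟩
    refine ⟨⟨?_, ?_⟩, ?_, ?_⟩ <;> simp only
    · have : 0 < 2 * (gridCoord ω n p).1 / n := by positivity
      linarith
    · have : 2 * (gridCoord ω n p).1 / n < 2 := by rw [div_lt_iff₀ hn']; linarith
      linarith
    · have : 0 < 2 * (gridCoord ω n p).2 / n := by positivity
      linarith
    · have : 2 * (gridCoord ω n p).2 / n < 2 := by rw [div_lt_iff₀ hn']; linarith
      linarith

theorem node_mem_domain_iff (ω : ℝ) {n : ℕ} (hn : n ≠ 0) (q : ℕ × ℕ) :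
    node ω n q ∈ domain ω ↔ q ∈ interiorNodes n := by
  rw [mem_domain_iff ω hn, gridCoord_node ω hn]
  simp [interiorNodes]

/-- The lower right half of the cell `(i,j)`, in grid coordinates. -/
def lowerCell (i j : ℕ) : Set (ℝ × ℝ) :=
  {x | (j : ℝ) ≤ x.2 ∧ x.2 - j ≤ x.1 - i ∧ x.1 ≤ i + 1}

/-- The upper left half of the cell `(i,j)`, in grid coordinates. -/
def upperCell (i j : ℕ) : Set (ℝ × ℝ) :=
  {x | (i : ℝ) ≤ x.1 ∧ x.1 - i ≤ x.2 - j ∧ x.2 ≤ j + 1}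

theorem gridCoord_convexComb (ω : ℝ) (n : ℕ) (p q : ℝ × ℝ) {a b : ℝ} (hab : a + b = 1) :
    gridCoord ω n (a • p + b • q) = a • gridCoord ω n p + b • gridCoord ω n q := by
  obtain rfl : b = 1 - a := by linarith
  ext <;> simp [gridCoord] <;> ring

theorem convex_gridCoord_preimage (ω : ℝ) (n : ℕ) {s : Set (ℝ × ℝ)} (hs : Convex ℝ s) :
    Convex ℝ (gridCoord ω n ⁻¹' s) := by
  intro p hp q hq a b ha hb hab
  rw [Set.mem_preimage, gridCoord_convexComb ω n p q hab]
  exact hs hp hq ha hb hab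

theorem convex_lowerCell (i j : ℕ) : Convex ℝ (lowerCell i j) := by
  intro p hp q hq a b ha hb hab
  obtain ⟨h1, h2, h3⟩ := hp
  obtain ⟨k1, k2, k3⟩ := hq
  obtain rfl : b = 1 - a := by linarith
  refine ⟨?_, ?_, ?_⟩ <;> simp only [Prod.fst_add, Prod.snd_add, Prod.smul_fst, Prod.smul_snd,
    smul_eq_mul] <;> nlinarith

theorem convex_upperCell (i j : ℕ) : Convex ℝ (upperCell i j) := by
  intro p hp q hq a b ha hb hab
  obtain ⟨h1, h2, h3⟩ := hp
  obtain ⟨k1, k2, k3⟩ := hq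
  obtain rfl : b = 1 - a := by linarith
  refine ⟨?_, ?_, ?_⟩ <;> simp only [Prod.fst_add, Prod.snd_add, Prod.smul_fst, Prod.smul_snd,
    smul_eq_mul] <;> nlinarith

theorem combo_mem_convexHull_triple {p q r : ℝ × ℝ} {a b c : ℝ} (ha : 0 ≤ a) (hb : 0 ≤ b)
    (hc : 0 ≤ c) (h : a + b + c = 1) : a • p + b • q + c • r ∈ convexHull ℝ {p, q, r} := by
  have := (convex_convexHull ℝ ({p, q, r} : Set (ℝ × ℝ))).sum_mem (t := Finset.univ)
    (w := ![a, b, c]) (z := ![p, q, r]) ?_ ?_ ?_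
  · simpa [Fin.sum_univ_three] using this
  · intro k _
    fin_cases k <;> simpa
  · simpa [Fin.sum_univ_three] using h
  · intro k _
    apply subset_convexHull
    fin_cases k <;> simp

theorem convexHull_lower (ω : ℝ) {n : ℕ} (hn : n ≠ 0) (i j : ℕ) :
    convexHull ℝ {node ω n (i, j), node ω n (i + 1, j), node ω n (i + 1, j + 1)} =
      gridCoord ω n ⁻¹' lowerCell i j := by
  apply Set.Subset.antisymm
  · refine convexHull_min ?_ (convex_gridCoord_preimage ω n (convex_lowerCell i j))
    rintro p (rfl | rfl | rfl) <;> rw [Set.mem_preimage, gridCoord_node ω hn] <;>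
      simp [lowerCell, add_comm]
  · rintro p ⟨h1, h2, h3⟩
    have key := combo_mem_convexHull_triple (p := node ω n (i, j)) (q := node ω n (i + 1, j))
      (r := node ω n (i + 1, j + 1)) (a := 1 - ((gridCoord ω n p).1 - i))
      (b := ((gridCoord ω n p).1 - i) - ((gridCoord ω n p).2 - j))
      (c := (gridCoord ω n p).2 - j) (by linarith) (by linarith) (by linarith) (by ring)
    convert key using 1
    conv_lhs => rw [← gridPoint_gridCoord ω hn p]
    ext <;> simp [node, gridPoint, rot] <;> ring

theorem convexHull_upper (ω : ℝ) {n : ℕ} (hn : n ≠ 0) (i j : ℕ) :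
    convexHull ℝ {node ω n (i, j), node ω n (i + 1, j + 1), node ω n (i, j + 1)} =
      gridCoord ω n ⁻¹' upperCell i j := by
  apply Set.Subset.antisymm
  · refine convexHull_min ?_ (convex_gridCoord_preimage ω n (convex_upperCell i j))
    rintro p (rfl | rfl | rfl) <;> rw [Set.mem_preimage, gridCoord_node ω hn] <;>
      simp [upperCell, add_comm]
  · rintro p ⟨h1, h2, h3⟩
    have key := combo_mem_convexHull_triple (p := node ω n (i, j)) (q := node ω n (i + 1, j + 1))
      (r := node ω n (i, j + 1)) (a := 1 - ((gridCoord ω n p).2 - j))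
      (b := (gridCoord ω n p).1 - i)
      (c := ((gridCoord ω n p).2 - j) - ((gridCoord ω n p).1 - i))
      (by linarith) (by linarith) (by linarith) (by ring)
    convert key using 1
    conv_lhs => rw [← gridPoint_gridCoord ω hn p]
    ext <;> simp [node, gridPoint, rot] <;> ring

/-- The mesh in grid coordinates: `triangles` consists of the half cells. -/
theorem forall_triangles_iff (ω : ℝ) {n : ℕ} (hn : n ≠ 0) (P : Set (ℝ × ℝ) → Prop) :
    (∀ T ∈ triangles ω n, P T) ↔ ∀ i j : ℕ, i < n → j < n →
      P (gridCoord ω n ⁻¹' lowerCell i j) ∧ P (gridCoord ω n ⁻¹' upperCell i j) := by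
  constructor
  · intro h i j hi hj
    exact ⟨h _ ⟨i, j, hi, hj, Or.inl (convexHull_lower ω hn i j).symm⟩,
      h _ ⟨i, j, hi, hj, Or.inr (convexHull_upper ω hn i j).symm⟩⟩
  · rintro h T ⟨i, j, hi, hj, rfl | rfl⟩
    · rw [convexHull_lower ω hn]
      exact (h i j hi hj).1
    · rw [convexHull_upper ω hn]
      exact (h i j hi hj).2

/-- Every point of the open square lies in a half cell. -/
theorem exists_mem_cell {n : ℕ} {x : ℝ × ℝ} (h1 : 0 < x.1) (h1' : x.1 < n) (h2 : 0 < x.2)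
    (h2' : x.2 < n) : ∃ i j : ℕ, i < n ∧ j < n ∧ (x ∈ lowerCell i j ∨ x ∈ upperCell i j) := by
  refine ⟨⌊x.1⌋₊, ⌊x.2⌋₊, (Nat.floor_lt h1.le).2 h1', (Nat.floor_lt h2.le).2 h2', ?_⟩
  have a1 := Nat.floor_le h1.le
  have a2 := Nat.floor_le h2.le
  have b1 := (Nat.lt_floor_add_one x.1).le
  have b2 := (Nat.lt_floor_add_one x.2).le
  rcases le_total (x.2 - ⌊x.2⌋₊) (x.1 - ⌊x.1⌋₊) with h | h
  · exact Or.inl ⟨a2, h, b1⟩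
  · exact Or.inr ⟨a1, h, b2⟩

/-! ### Finite element functions and their nodal values -/

/-- The nodal values of a function, as a grid function. For a finite element function they vanish
outside the interior vertices, also at the indices beyond the mesh. -/
noncomputable def nodalValues (ω : ℝ) (n : ℕ) : Fun →ₗ[ℝ] (ℕ × ℕ → ℝ) where
  toFun v q := v (node ω n q)
  map_add' _ _ := rfl
  map_smul' _ _ := rfl

@[simp]
theorem nodalValues_apply (ω : ℝ) (n : ℕ) (v : Fun) (q : ℕ × ℕ) :
    nodalValues ω n v q = v (node ω n q) := rfl

theorem nodalValues_eq_zero {ω : ℝ} {n : ℕ} (hn : n ≠ 0) {v : Fun} (hv : v ∈ femSpace ω n)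
    {q : ℕ × ℕ} (hq : q ∉ interiorNodes n) : nodalValues ω n v q = 0 :=
  hv.2.1 _ (mt (node_mem_domain_iff ω hn q).1 hq)

theorem eq_on_lowerCell {ω : ℝ} {n : ℕ} (hn : n ≠ 0) {v : Fun} (hv : v ∈ femSpace ω n) {i j : ℕ}
    (hi : i < n) (hj : j < n) {p : ℝ × ℝ} (hp : gridCoord ω n p ∈ lowerCell i j) :
    v p = nodalValues ω n v (i, j) +
      ((gridCoord ω n p).1 - i) * (nodalValues ω n v (i + 1, j) - nodalValues ω n v (i, j)) +
      ((gridCoord ω n p).2 - j) *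
        (nodalValues ω n v (i + 1, j + 1) - nodalValues ω n v (i + 1, j)) := by
  obtain ⟨a, b, c, h⟩ := ((forall_triangles_iff ω hn _).1 hv.2.2 i j hi hj).1
  have hmem : ∀ q : ℕ × ℕ, ((q.1 : ℝ), (q.2 : ℝ)) ∈ lowerCell i j →
      node ω n q ∈ gridCoord ω n ⁻¹' lowerCell i j := fun q hq => by
    rwa [Set.mem_preimage, gridCoord_node ω hn]
  simp only [nodalValues_apply]
  rw [h p hp, h _ (hmem (i, j) (by simp [lowerCell])),
    h _ (hmem (i + 1, j) (by simp [lowerCell])),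
    h _ (hmem (i + 1, j + 1) (by simp [lowerCell, add_comm]))]
  conv_lhs => rw [← gridPoint_gridCoord ω hn p]
  simp only [node, gridPoint, rot]
  push_cast
  ring

theorem eq_on_upperCell {ω : ℝ} {n : ℕ} (hn : n ≠ 0) {v : Fun} (hv : v ∈ femSpace ω n) {i j : ℕ}
    (hi : i < n) (hj : j < n) {p : ℝ × ℝ} (hp : gridCoord ω n p ∈ upperCell i j) :
    v p = nodalValues ω n v (i, j) +
      ((gridCoord ω n p).1 - i) *
        (nodalValues ω n v (i + 1, j + 1) - nodalValues ω n v (i, j + 1)) +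
      ((gridCoord ω n p).2 - j) *
        (nodalValues ω n v (i, j + 1) - nodalValues ω n v (i, j)) := by
  obtain ⟨a, b, c, h⟩ := ((forall_triangles_iff ω hn _).1 hv.2.2 i j hi hj).2
  have hmem : ∀ q : ℕ × ℕ, ((q.1 : ℝ), (q.2 : ℝ)) ∈ upperCell i j →
      node ω n q ∈ gridCoord ω n ⁻¹' upperCell i j := fun q hq => by
    rwa [Set.mem_preimage, gridCoord_node ω hn]
  simp only [nodalValues_apply]
  rw [h p hp, h _ (hmem (i, j) (by simp [upperCell])),
    h _ (hmem (i, j + 1) (by simp [upperCell])),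
    h _ (hmem (i + 1, j + 1) (by simp [upperCell, add_comm]))]
  conv_lhs => rw [← gridPoint_gridCoord ω hn p]
  simp only [node, gridPoint, rot]
  push_cast
  ring

theorem eq_zero_of_nodalValues {ω : ℝ} {n : ℕ} (hn : n ≠ 0) {v : Fun} (hv : v ∈ femSpace ω n)
    (h : nodalValues ω n v = 0) : v = 0 := by
  funext p
  by_cases hp : p ∈ domain ω
  · obtain ⟨⟨h1, h1'⟩, h2, h2'⟩ := (mem_domain_iff ω hn p).1 hp
    obtain ⟨i, j, hi, hj, hc | hc⟩ := exists_mem_cell h1 h1' h2 h2'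
    · rw [eq_on_lowerCell hn hv hi hj hc, h]
      simp
    · rw [eq_on_upperCell hn hv hi hj hc, h]
      simp
  · exact hv.2.1 p hp

theorem nodalValues_injOn {ω : ℝ} {n : ℕ} (hn : n ≠ 0) {u v : Fun} (hu : u ∈ femSpace ω n)
    (hv : v ∈ femSpace ω n) (h : nodalValues ω n u = nodalValues ω n v) : u = v :=
  sub_eq_zero.1 (eq_zero_of_nodalValues hn (Submodule.sub_mem _ hu hv)
    (by rw [map_sub, h, sub_self]))

/-- The nodal basis function of the origin, in grid coordinates: the piecewise affine function on
the hexagon with the vertices `±(1,0)`, `±(0,1)`, `±(1,1)`. -/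
noncomputable def hat (x : ℝ × ℝ) : ℝ :=
  max 0 (1 - max (max |x.1| |x.2|) |x.1 - x.2|)

theorem continuous_hat : Continuous hat := by
  unfold hat
  fun_prop

theorem hat_eq_zero {x : ℝ × ℝ} (h : 1 ≤ |x.1| ∨ 1 ≤ |x.2| ∨ 1 ≤ |x.1 - x.2|) : hat x = 0 := by
  have : 1 ≤ max (max |x.1| |x.2|) |x.1 - x.2| := by
    simpa only [le_max_iff, or_assoc] using h
  exact max_eq_left (by linarith)

theorem hat_lower {x : ℝ × ℝ} (h1 : 0 ≤ x.2) (h2 : x.2 ≤ x.1) (h3 : x.1 ≤ 1) :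
    hat x = 1 - x.1 := by
  rw [hat, abs_of_nonneg h1, abs_of_nonneg (h1.trans h2), abs_of_nonneg (sub_nonneg.2 h2),
    max_eq_left h2, max_eq_left (sub_le_self _ h1), max_eq_right (by linarith)]

theorem hat_neg (x : ℝ × ℝ) : hat (-x) = hat x := by
  have : -x.1 - -x.2 = -(x.1 - x.2) := by ring
  simp only [hat, Prod.fst_neg, Prod.snd_neg, abs_neg, this]

theorem hat_swap (x : ℝ × ℝ) : hat x.swap = hat x := by
  simp only [hat, Prod.fst_swap, Prod.snd_swap, abs_sub_comm x.2 x.1, max_comm |x.2| |x.1|]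

theorem hat_middle {x : ℝ × ℝ} (h1 : x.1 ≤ 0) (h2 : 0 ≤ x.2) (h3 : x.2 - x.1 ≤ 1) :
    hat x = 1 - (x.2 - x.1) := by
  rw [hat, abs_of_nonneg h2, abs_of_nonpos h1, abs_of_nonpos (by linarith), neg_sub,
    max_eq_right (max_le (by linarith) (by linarith)), max_eq_right (by linarith)]

/-- On every half cell a translated hat function is affine. -/
theorem hat_affine_lowerCell (q : ℕ × ℕ) (i j : ℕ) : ∃ a b c : ℝ, ∀ x ∈ lowerCell i j,
    hat (x - ((q.1 : ℝ), (q.2 : ℝ))) = a * x.1 + b * x.2 + c := by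
  obtain ⟨k, l⟩ := q
  by_cases h00 : k = i ∧ l = j
  · obtain ⟨rfl, rfl⟩ := h00
    refine ⟨-1, 0, 1 + k, fun x ⟨h1, h2, h3⟩ => ?_⟩
    rw [hat_lower] <;> simp <;> linarith
  by_cases h10 : k = i + 1 ∧ l = j
  · obtain ⟨rfl, rfl⟩ := h10
    refine ⟨1, -1, l - i, fun x ⟨h1, h2, h3⟩ => ?_⟩
    rw [hat_middle] <;> simp <;> linarith
  by_cases h11 : k = i + 1 ∧ l = j + 1
  · obtain ⟨rfl, rfl⟩ := h11
    refine ⟨0, 1, -j, fun x ⟨h1, h2, h3⟩ => ?_⟩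
    rw [← hat_neg, ← hat_swap, hat_lower] <;> simp <;> linarith
  refine ⟨0, 0, 0, fun x ⟨h1, h2, h3⟩ => ?_⟩
  rw [hat_eq_zero, zero_mul, zero_mul, add_zero, add_zero]
  simp only [Prod.fst_sub, Prod.snd_sub, le_abs]
  have hcases : k + 1 ≤ i ∨ i + 2 ≤ k ∨ l + 1 ≤ j ∨ j + 2 ≤ l ∨ (k = i ∧ l = j + 1) := by omega
  rcases hcases with h | h | h | h | ⟨rfl, rfl⟩
  · have : (k : ℝ) + 1 ≤ i := by exact_mod_cast h
    exact Or.inl (Or.inl (by linarith))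
  · have : (i : ℝ) + 2 ≤ k := by exact_mod_cast h
    exact Or.inl (Or.inr (by linarith))
  · have : (l : ℝ) + 1 ≤ j := by exact_mod_cast h
    exact Or.inr (Or.inl (Or.inl (by linarith)))
  · have : (j : ℝ) + 2 ≤ l := by exact_mod_cast h
    exact Or.inr (Or.inl (Or.inr (by linarith)))
  · refine Or.inr (Or.inr (Or.inl ?_))
    push_cast
    linarith

theorem hat_affine_upperCell (q : ℕ × ℕ) (i j : ℕ) : ∃ a b c : ℝ, ∀ x ∈ upperCell i j,
    hat (x - ((q.1 : ℝ), (q.2 : ℝ))) = a * x.1 + b * x.2 + c := by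
  -- the reflection in the diagonal exchanges the two kinds of half cells and preserves `hat`
  obtain ⟨a, b, c, h⟩ := hat_affine_lowerCell q.swap j i
  refine ⟨b, a, c, fun x hx => ?_⟩
  have := h x.swap hx
  rw [← hat_swap] at this
  simp only [Prod.swap_sub, Prod.swap_swap, Prod.fst_swap, Prod.snd_swap, Prod.swap_prod_mk]
    at this
  rw [this]
  ring

theorem hat_int (q r : ℕ × ℕ) :
    hat (((r.1 : ℝ), (r.2 : ℝ)) - ((q.1 : ℝ), (q.2 : ℝ))) = if r = q then 1 else 0 := by
  split_ifs with h
  · simp [h, hat]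
  · apply hat_eq_zero
    have : r.1 ≠ q.1 ∨ r.2 ≠ q.2 := by
      by_contra! hc
      exact h (Prod.ext hc.1 hc.2)
    have hcast : ∀ a b : ℕ, a ≠ b → (1 : ℝ) ≤ |(a : ℝ) - b| := fun a b hab => by
      have : (1 : ℤ) ≤ |(a : ℤ) - b| := Int.one_le_abs (by omega)
      exact_mod_cast this
    rcases this with h | h
    · exact Or.inl (hcast _ _ h)
    · exact Or.inr (Or.inl (hcast _ _ h))

/-- The nodal basis function of the vertex `q`. -/
noncomputable def nodalBasis (ω : ℝ) (n : ℕ) (q : ℕ × ℕ) : Fun :=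
  fun p => hat (gridCoord ω n p - ((q.1 : ℝ), (q.2 : ℝ)))

theorem nodalBasis_mem {ω : ℝ} {n : ℕ} (hn : n ≠ 0) {q : ℕ × ℕ} (hq : q ∈ interiorNodes n) :
    nodalBasis ω n q ∈ femSpace ω n := by
  refine ⟨continuous_hat.comp ((continuous_gridCoord ω n).sub continuous_const), ?_, ?_⟩
  · intro p hp
    apply hat_eq_zero
    rw [mem_domain_iff ω hn] at hp
    simp only [interiorNodes, Finset.mem_product, Finset.mem_Ioo] at hq
    obtain ⟨⟨a1, a2⟩, a3, a4⟩ := hq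
    have b1 : (1 : ℝ) ≤ q.1 := by exact_mod_cast a1
    have b2 : (q.1 : ℝ) + 1 ≤ n := by exact_mod_cast a2
    have b3 : (1 : ℝ) ≤ q.2 := by exact_mod_cast a3
    have b4 : (q.2 : ℝ) + 1 ≤ n := by exact_mod_cast a4
    simp only [Prod.fst_sub, Prod.snd_sub, le_abs]
    by_contra! hc
    obtain ⟨⟨c1, c2⟩, ⟨c3, c4⟩, -⟩ := hc
    exact hp ⟨⟨by linarith, by linarith⟩, by linarith, by linarith⟩
  · have aff : ∀ s : Set (ℝ × ℝ), (∃ a b c : ℝ, ∀ x ∈ s,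
        hat (x - ((q.1 : ℝ), (q.2 : ℝ))) = a * x.1 + b * x.2 + c) →
        ∃ a b c : ℝ, ∀ p ∈ gridCoord ω n ⁻¹' s, nodalBasis ω n q p = a * p.1 + b * p.2 + c := by
      rintro s ⟨a, b, c, h⟩
      refine ⟨n / 2 * (a * Real.cos ω - b * Real.sin ω), n / 2 * (a * Real.sin ω + b * Real.cos ω),
        n / 2 * (a + b) + c, fun p hp => ?_⟩
      rw [nodalBasis, h _ hp]
      simp only [gridCoord]
      ring
    rw [forall_triangles_iff ω hn]
    exact fun i j _ _ => ⟨aff _ (hat_affine_lowerCell q i j), aff _ (hat_affine_upperCell q i j)⟩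

theorem nodalValues_nodalBasis (ω : ℝ) {n : ℕ} (hn : n ≠ 0) (q : ℕ × ℕ) :
    nodalValues ω n (nodalBasis ω n q) = Pi.single q 1 := by
  funext r
  rw [nodalValues_apply, nodalBasis, gridCoord_node ω hn, hat_int, Pi.single_apply]

/-- Grid functions that vanish off the interior vertices are interpolated by finite element
functions. -/
theorem exists_nodalValues_eq (ω : ℝ) {n : ℕ} (hn : n ≠ 0) (f : ℕ × ℕ → ℝ)
    (hf : ∀ q, q ∉ interiorNodes n → f q = 0) :
    ∃ v ∈ femSpace ω n, nodalValues ω n v = f := by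
  refine ⟨∑ q ∈ interiorNodes n, f q • nodalBasis ω n q, Submodule.sum_mem _ fun q hq =>
    Submodule.smul_mem _ _ (nodalBasis_mem hn hq), ?_⟩
  rw [map_sum]
  funext r
  simp only [map_smul, nodalValues_nodalBasis ω hn, Finset.sum_apply, Pi.smul_apply,
    Pi.single_apply, smul_eq_mul, mul_ite, mul_one, mul_zero, Finset.sum_ite_eq]
  split_ifs with h
  · rfl
  · exact (hf r h).symm

theorem eq_sum_nodalBasis {ω : ℝ} {n : ℕ} (hn : n ≠ 0) {v : Fun} (hv : v ∈ femSpace ω n) :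
    ∑ q ∈ interiorNodes n, nodalValues ω n v q • nodalBasis ω n q = v := by
  refine nodalValues_injOn hn (Submodule.sum_mem _ fun q hq =>
    Submodule.smul_mem _ _ (nodalBasis_mem hn hq)) hv ?_
  rw [map_sum]
  funext r
  simp only [map_smul, nodalValues_nodalBasis ω hn, Finset.sum_apply, Pi.smul_apply,
    Pi.single_apply, smul_eq_mul, mul_ite, mul_one, mul_zero, Finset.sum_ite_eq]
  split_ifs with h
  · rfl
  · exact (nodalValues_eq_zero hn hv h).symm

theorem finiteDimensional_femSpace (ω : ℝ) {n : ℕ} (hn : n ≠ 0) :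
    FiniteDimensional ℝ (femSpace ω n) := by
  have hspan : femSpace ω n ≤ Submodule.span ℝ (nodalBasis ω n '' interiorNodes n) := by
    intro v hv
    rw [← eq_sum_nodalBasis hn hv]
    exact Submodule.sum_mem _ fun q hq => Submodule.smul_mem _ _
      (Submodule.subset_span ⟨q, hq, rfl⟩)
  have : FiniteDimensional ℝ (Submodule.span ℝ (nodalBasis ω n '' interiorNodes n)) :=
    FiniteDimensional.span_of_finite ℝ ((interiorNodes n).finite_toSet.image _)
  exact Submodule.finiteDimensional_of_le hspan

/-! ### Refinement of the mesh -/

theorem gridCoord_two_mul (ω : ℝ) (N : ℕ) (p : ℝ × ℝ) :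
    gridCoord ω (2 * N) p = (2 : ℝ) • gridCoord ω N p := by
  ext <;> simp [gridCoord] <;> ring

theorem femSpace_le_refine (ω : ℝ) {N : ℕ} (hN : N ≠ 0) :
    femSpace ω N ≤ femSpace ω (2 * N) := by
  rintro v ⟨hc, h0, haff⟩
  refine ⟨hc, h0, ?_⟩
  rw [forall_triangles_iff ω hN] at haff
  rw [forall_triangles_iff ω (by omega)]
  -- the coarse half cell that contains a given fine half cell is found from the parities
  have sub : ∀ s t : Set (ℝ × ℝ), (∀ x : ℝ × ℝ, (2 : ℝ) • x ∈ s → x ∈ t) →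
      (∃ a b c : ℝ, ∀ p ∈ gridCoord ω N ⁻¹' t, v p = a * p.1 + b * p.2 + c) →
      ∃ a b c : ℝ, ∀ p ∈ gridCoord ω (2 * N) ⁻¹' s, v p = a * p.1 + b * p.2 + c := by
    rintro s t hst ⟨a, b, c, h⟩
    refine ⟨a, b, c, fun p hp => h p (hst _ ?_)⟩
    rwa [← gridCoord_two_mul]
  intro i j hi hj
  obtain ⟨I, rfl | rfl⟩ := Nat.even_or_odd' i <;> obtain ⟨J, rfl | rfl⟩ := Nat.even_or_odd' j <;>
    obtain ⟨hl, hu⟩ := haff I J (by omega) (by omega)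
  · refine ⟨sub _ _ ?_ hl, sub _ _ ?_ hu⟩ <;> rintro x ⟨h1, h2, h3⟩ <;> simp at h1 h2 h3 <;>
      refine ⟨?_, ?_, ?_⟩ <;> linarith
  · refine ⟨sub _ _ ?_ hu, sub _ _ ?_ hu⟩ <;> rintro x ⟨h1, h2, h3⟩ <;> simp at h1 h2 h3 <;>
      refine ⟨?_, ?_, ?_⟩ <;> linarith
  · refine ⟨sub _ _ ?_ hl, sub _ _ ?_ hl⟩ <;> rintro x ⟨h1, h2, h3⟩ <;> simp at h1 h2 h3 <;>
      refine ⟨?_, ?_, ?_⟩ <;> linarith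
  · refine ⟨sub _ _ ?_ hl, sub _ _ ?_ hu⟩ <;> rintro x ⟨h1, h2, h3⟩ <;> simp at h1 h2 h3 <;>
      refine ⟨?_, ?_, ?_⟩ <;> linarith

theorem nodalValues_refine_even (ω : ℝ) {N : ℕ} (v : Fun) (I J : ℕ) :
    nodalValues ω (2 * N) v (2 * I, 2 * J) = nodalValues ω N v (I, J) := by
  simp only [nodalValues_apply, node]
  push_cast
  simp only [mul_div_mul_left _ _ (two_ne_zero : (2 : ℝ) ≠ 0), mul_left_comm (2 : ℝ)]

theorem gridCoord_node_refine (ω : ℝ) {N : ℕ} (hN : N ≠ 0) (q : ℕ × ℕ) :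
    gridCoord ω N (node ω (2 * N) q) = ((q.1 : ℝ) / 2, (q.2 : ℝ) / 2) := by
  have h := gridCoord_two_mul ω N (node ω (2 * N) q)
  rw [gridCoord_node ω (by omega)] at h
  have h1 := congrArg Prod.fst h
  have h2 := congrArg Prod.snd h
  simp at h1 h2
  ext <;> simp <;> linarith

theorem nodalValues_refine_horizontal {ω : ℝ} {N : ℕ} {v : Fun} (hv : v ∈ femSpace ω N) {I J : ℕ}
    (hI : I < N) (hJ : J < N) : nodalValues ω (2 * N) v (2 * I + 1, 2 * J) =
      (nodalValues ω N v (I, J) + nodalValues ω N v (I + 1, J)) / 2 := by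
  have hN : N ≠ 0 := by omega
  have hg := gridCoord_node_refine ω hN (2 * I + 1, 2 * J)
  rw [nodalValues_apply, eq_on_lowerCell hN hv hI hJ (by
    rw [hg]; simp [lowerCell]; constructor <;> linarith), hg]
  push_cast
  ring

theorem nodalValues_refine_vertical {ω : ℝ} {N : ℕ} {v : Fun} (hv : v ∈ femSpace ω N) {I J : ℕ}
    (hI : I < N) (hJ : J < N) : nodalValues ω (2 * N) v (2 * I, 2 * J + 1) =
      (nodalValues ω N v (I, J) + nodalValues ω N v (I, J + 1)) / 2 := by
  have hN : N ≠ 0 := by omega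
  have hg := gridCoord_node_refine ω hN (2 * I, 2 * J + 1)
  rw [nodalValues_apply, eq_on_upperCell hN hv hI hJ (by
    rw [hg]; simp [upperCell]; constructor <;> linarith), hg]
  push_cast
  ring

theorem nodalValues_refine_diagonal {ω : ℝ} {N : ℕ} {v : Fun} (hv : v ∈ femSpace ω N) {I J : ℕ}
    (hI : I < N) (hJ : J < N) : nodalValues ω (2 * N) v (2 * I + 1, 2 * J + 1) =
      (nodalValues ω N v (I, J) + nodalValues ω N v (I + 1, J + 1)) / 2 := by
  have hN : N ≠ 0 := by omega
  have hg := gridCoord_node_refine ω hN (2 * I + 1, 2 * J + 1)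
  rw [nodalValues_apply, eq_on_lowerCell hN hv hI hJ (by
    rw [hg]; simp [lowerCell]; refine ⟨?_, ?_, ?_⟩ <;> linarith), hg]
  push_cast
  ring

/-! ### The energy form in terms of nodal values -/

/-- The interior of the lower right half of the cell `(i,j)`, in grid coordinates. -/
def lowerInterior (i j : ℕ) : Set (ℝ × ℝ) :=
  {x | (j : ℝ) < x.2 ∧ x.2 - j < x.1 - i ∧ x.1 < i + 1}

/-- The interior of the upper left half of the cell `(i,j)`, in grid coordinates. -/
def upperInterior (i j : ℕ) : Set (ℝ × ℝ) :=
  {x | (i : ℝ) < x.1 ∧ x.1 - i < x.2 - j ∧ x.2 < j + 1}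

theorem lowerInterior_subset (i j : ℕ) : lowerInterior i j ⊆ lowerCell i j :=
  fun _ h => ⟨h.1.le, h.2.1.le, h.2.2.le⟩

theorem upperInterior_subset (i j : ℕ) : upperInterior i j ⊆ upperCell i j :=
  fun _ h => ⟨h.1.le, h.2.1.le, h.2.2.le⟩

theorem isOpen_lowerInterior (i j : ℕ) : IsOpen (lowerInterior i j) := by
  simp only [lowerInterior, Set.ofPred_and]
  exact (isOpen_lt (by fun_prop) (by fun_prop)).inter
    ((isOpen_lt (by fun_prop) (by fun_prop)).inter (isOpen_lt (by fun_prop) (by fun_prop)))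

theorem isOpen_upperInterior (i j : ℕ) : IsOpen (upperInterior i j) := by
  simp only [upperInterior, Set.ofPred_and]
  exact (isOpen_lt (by fun_prop) (by fun_prop)).inter
    ((isOpen_lt (by fun_prop) (by fun_prop)).inter (isOpen_lt (by fun_prop) (by fun_prop)))

theorem volume_lowerInterior (i j : ℕ) : volume (lowerInterior i j) = ENNReal.ofReal (1 / 2) := by
  have h : lowerInterior i j = (fun x => x + (-(i : ℝ), -(j : ℝ))) ⁻¹'
      regionBetween (fun _ => 0) (fun s => s) (Set.Ioo 0 1) := by
    ext x
    simp only [lowerInterior, regionBetween, Set.mem_ofPred_eq, Set.mem_preimage, Set.mem_Ioo,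
      Prod.fst_add, Prod.snd_add]
    constructor
    · rintro ⟨h1, h2, h3⟩
      refine ⟨⟨?_, ?_⟩, ?_, ?_⟩ <;> linarith
    · rintro ⟨⟨h1, h2⟩, h3, h4⟩
      refine ⟨?_, ?_, ?_⟩ <;> linarith
  rw [h, measure_preimage_add_right, Measure.volume_eq_prod,
    volume_regionBetween_eq_integral ?_ ?_ measurableSet_Ioo (fun x hx => hx.1.le)]
  · rw [← integral_Ioc_eq_integral_Ioo, ← intervalIntegral.integral_of_le zero_le_one]
    simp
  · exact integrableOn_const (by simp)
  · exact (continuous_id.integrableOn_Icc (a := (0 : ℝ)) (b := 1)).mono_set Set.Ioo_subset_Icc_self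

theorem volume_upperInterior (i j : ℕ) : volume (upperInterior i j) = ENNReal.ofReal (1 / 2) := by
  rw [← volume_lowerInterior j i, Measure.volume_eq_prod,
    ← (Measure.measurePreserving_swap (μ := (volume : Measure ℝ)) (ν := (volume : Measure ℝ))
      ).measure_preimage (isOpen_lowerInterior j i).measurableSet.nullMeasurableSet]
  rfl

/-- The linear part of `gridCoord`. -/
noncomputable def gridLinear (ω : ℝ) (n : ℕ) : ℝ × ℝ →ₗ[ℝ] ℝ × ℝ :=
  Matrix.toLin (Module.Basis.finTwoProd ℝ) (Module.Basis.finTwoProd ℝ)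
    !![(n : ℝ) / 2 * Real.cos ω, (n : ℝ) / 2 * Real.sin ω;
      -((n : ℝ) / 2 * Real.sin ω), (n : ℝ) / 2 * Real.cos ω]

theorem gridCoord_eq_linear (ω : ℝ) (n : ℕ) (p : ℝ × ℝ) :
    gridCoord ω n p = gridLinear ω n p + ((n : ℝ) / 2, (n : ℝ) / 2) := by
  rw [gridLinear, Matrix.toLin_finTwoProd_apply]
  ext <;> simp [gridCoord] <;> ring

theorem det_gridLinear (ω : ℝ) (n : ℕ) : LinearMap.det (gridLinear ω n) = (n : ℝ) ^ 2 / 4 := by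
  rw [gridLinear, LinearMap.det_toLin, Matrix.det_fin_two_of]
  linear_combination (n : ℝ) ^ 2 / 4 * Real.sin_sq_add_cos_sq ω

theorem volume_gridCoord_preimage (ω : ℝ) {n : ℕ} (hn : n ≠ 0) (s : Set (ℝ × ℝ)) :
    volume (gridCoord ω n ⁻¹' s) = ENNReal.ofReal (4 / (n : ℝ) ^ 2) * volume s := by
  have hn' : (n : ℝ) ≠ 0 := Nat.cast_ne_zero.mpr hn
  have h : gridCoord ω n ⁻¹' s =
      gridLinear ω n ⁻¹' ((fun x => x + ((n : ℝ) / 2, (n : ℝ) / 2)) ⁻¹' s) := by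
    ext p
    simp only [Set.mem_preimage, gridCoord_eq_linear]
  rw [h, Measure.addHaar_preimage_linearMap _ (by rw [det_gridLinear]; positivity),
    measure_preimage_add_right, det_gridLinear, inv_div, abs_of_nonneg (by positivity)]

/-- Lines are null sets. -/
theorem volume_line {a b : ℝ} (hab : a ≠ 0 ∨ b ≠ 0) (c : ℝ) :
    volume {x : ℝ × ℝ | a * x.1 + b * x.2 = c} = 0 := by
  let ℓ : ℝ × ℝ →ₗ[ℝ] ℝ := a • LinearMap.fst ℝ ℝ ℝ + b • LinearMap.snd ℝ ℝ ℝ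
  have hℓ : ∀ x, ℓ x = a * x.1 + b * x.2 := fun x => rfl
  have hker : volume (LinearMap.ker ℓ : Set (ℝ × ℝ)) = 0 := by
    apply Measure.addHaar_submodule
    intro htop
    have h1 : ((1 : ℝ), (0 : ℝ)) ∈ LinearMap.ker ℓ := htop ▸ Submodule.mem_top
    have h2 : ((0 : ℝ), (1 : ℝ)) ∈ LinearMap.ker ℓ := htop ▸ Submodule.mem_top
    rw [LinearMap.mem_ker, hℓ] at h1 h2
    simp only [mul_one, mul_zero, add_zero, zero_add] at h1 h2
    exact hab.elim (· h1) (· h2)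
  rcases Set.eq_empty_or_nonempty {x : ℝ × ℝ | a * x.1 + b * x.2 = c} with h | ⟨x₀, hx₀⟩
  · rw [h, measure_empty]
  · have : {x : ℝ × ℝ | a * x.1 + b * x.2 = c} =
        (fun x => x + -x₀) ⁻¹' (LinearMap.ker ℓ : Set (ℝ × ℝ)) := by
      ext x
      rw [Set.mem_ofPred_eq] at hx₀
      simp only [Set.mem_ofPred_eq, Set.mem_preimage, SetLike.mem_coe, LinearMap.mem_ker, hℓ,
        Prod.fst_add, Prod.snd_add, Prod.fst_neg, Prod.snd_neg]
      constructor <;> intro h <;> linarith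
    rw [this, measure_preimage_add_right, hker]

/-- The union of all mesh lines, in grid coordinates. -/
def meshLines : Set (ℝ × ℝ) :=
  {x | ∃ k : ℤ, x.1 = k ∨ x.2 = k ∨ x.1 - x.2 = k}

theorem volume_meshLines : volume meshLines = 0 := by
  have h : meshLines ⊆ ⋃ k : ℤ, ({x : ℝ × ℝ | 1 * x.1 + 0 * x.2 = k} ∪
      ({x : ℝ × ℝ | 0 * x.1 + 1 * x.2 = k} ∪ {x : ℝ × ℝ | 1 * x.1 + (-1) * x.2 = k})) := by
    rintro x ⟨k, h⟩
    refine Set.mem_iUnion.2 ⟨k, ?_⟩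
    simp only [Set.mem_union, Set.mem_ofPred_eq]
    rcases h with h | h | h
    · exact Or.inl (by linarith)
    · exact Or.inr (Or.inl (by linarith))
    · exact Or.inr (Or.inr (by linarith))
  refine measure_mono_null h (measure_iUnion_null fun k => measure_union_null ?_
    (measure_union_null ?_ ?_)) <;> exact volume_line (by norm_num) _

/-- The open triangles of the mesh, indexed by the cell and by the half of the cell. -/
def openTriangle (ω : ℝ) (n : ℕ) (k : (ℕ × ℕ) × Bool) : Set (ℝ × ℝ) :=
  gridCoord ω n ⁻¹' (if k.2 then lowerInterior k.1.1 k.1.2 else upperInterior k.1.1 k.1.2)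

/-- The index set of the triangles of the mesh. -/
def triangleIndices (n : ℕ) : Finset ((ℕ × ℕ) × Bool) :=
  (Finset.range n ×ˢ Finset.range n) ×ˢ Finset.univ

theorem isOpen_openTriangle (ω : ℝ) (n : ℕ) (k : (ℕ × ℕ) × Bool) :
    IsOpen (openTriangle ω n k) := by
  refine IsOpen.preimage (continuous_gridCoord ω n) ?_
  split_ifs
  · exact isOpen_lowerInterior _ _
  · exact isOpen_upperInterior _ _

theorem volume_openTriangle (ω : ℝ) {n : ℕ} (hn : n ≠ 0) (k : (ℕ × ℕ) × Bool) :
    volume (openTriangle ω n k) = ENNReal.ofReal (2 / (n : ℝ) ^ 2) := by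
  have h : volume (if k.2 then lowerInterior k.1.1 k.1.2 else upperInterior k.1.1 k.1.2) =
      ENNReal.ofReal (1 / 2) := by
    split_ifs
    · exact volume_lowerInterior _ _
    · exact volume_upperInterior _ _
  rw [openTriangle, volume_gridCoord_preimage ω hn, h, ← ENNReal.ofReal_mul (by positivity)]
  congr 1
  ring

theorem floor_of_mem {i j : ℕ} {x : ℝ × ℝ} (h : x ∈ lowerInterior i j ∨ x ∈ upperInterior i j) :
    ⌊x.1⌋₊ = i ∧ ⌊x.2⌋₊ = j := by
  have hx : ((i : ℝ) < x.1 ∧ x.1 < i + 1) ∧ (j : ℝ) < x.2 ∧ x.2 < j + 1 := by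
    rcases h with ⟨h1, h2, h3⟩ | ⟨h1, h2, h3⟩ <;> refine ⟨⟨?_, ?_⟩, ?_, ?_⟩ <;> linarith
  obtain ⟨⟨h1, h2⟩, h3, h4⟩ := hx
  have hi : (0 : ℝ) ≤ i := i.cast_nonneg
  have hj : (0 : ℝ) ≤ j := j.cast_nonneg
  exact ⟨(Nat.floor_eq_iff (by linarith)).2 ⟨h1.le, h2⟩,
    (Nat.floor_eq_iff (by linarith)).2 ⟨h3.le, h4⟩⟩

theorem pairwise_disjoint_openTriangle (ω : ℝ) (n : ℕ) :
    Pairwise (Function.onFun Disjoint (openTriangle ω n)) := by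
  rintro ⟨⟨i, j⟩, b⟩ ⟨⟨i', j'⟩, b'⟩ hne
  refine Disjoint.preimage _ (Set.disjoint_left.2 fun x hx hx' => hne ?_)
  have hfl : ∀ (i j : ℕ) (b : Bool), x ∈ (if b then lowerInterior i j else upperInterior i j) →
      ⌊x.1⌋₊ = i ∧ ⌊x.2⌋₊ = j := by
    intro i j b h
    cases b
    · exact floor_of_mem (Or.inr h)
    · exact floor_of_mem (Or.inl h)
  obtain ⟨rfl, rfl⟩ := hfl i j b hx
  obtain ⟨h1, h2⟩ := hfl i' j' b' hx'
  subst h1 h2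
  cases b <;> cases b' <;> first | rfl | skip
  · have h1 := hx.2.1
    have h2 := hx'.2.1
    simp only at h1 h2
    exact absurd h1 h2.not_gt
  · have h1 := hx.2.1
    have h2 := hx'.2.1
    simp only at h1 h2
    exact absurd h1 h2.not_gt

/-- Up to a null set the domain is the union of the open triangles of the mesh. -/
theorem domain_ae_eq (ω : ℝ) {n : ℕ} (hn : n ≠ 0) :
    domain ω =ᵐ[volume] ⋃ k ∈ triangleIndices n, openTriangle ω n k := by
  have hnull : volume (gridCoord ω n ⁻¹' meshLines) = 0 := by
    rw [volume_gridCoord_preimage ω hn, volume_meshLines, mul_zero]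
  have hae : ∀ᵐ p : ℝ × ℝ, gridCoord ω n p ∉ meshLines := measure_eq_zero_iff_ae_notMem.1 hnull
  filter_upwards [hae] with p hp
  refine propext (?_ : p ∈ domain ω ↔ p ∈ ⋃ k ∈ triangleIndices n, openTriangle ω n k)
  rw [mem_domain_iff ω hn]
  set x := gridCoord ω n p with hx
  simp only [Set.mem_iUnion, exists_prop, triangleIndices, Finset.mem_product, Finset.mem_range,
    Finset.mem_univ, and_true]
  constructor
  · rintro ⟨⟨h1, h1'⟩, h2, h2'⟩
    have a1 := Nat.floor_le h1.le
    have a2 := Nat.floor_le h2.le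
    have b1 := Nat.lt_floor_add_one x.1
    have b2 := Nat.lt_floor_add_one x.2
    have c1 : (⌊x.1⌋₊ : ℝ) < x.1 := lt_of_le_of_ne a1 fun h =>
      hp ⟨⌊x.1⌋₊, Or.inl (by rw [Int.cast_natCast]; exact h.symm)⟩
    have c2 : (⌊x.2⌋₊ : ℝ) < x.2 := lt_of_le_of_ne a2 fun h =>
      hp ⟨⌊x.2⌋₊, Or.inr (Or.inl (by rw [Int.cast_natCast]; exact h.symm))⟩
    have c3 : x.2 - ⌊x.2⌋₊ ≠ x.1 - ⌊x.1⌋₊ := fun h =>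
      hp ⟨(⌊x.1⌋₊ : ℤ) - ⌊x.2⌋₊, Or.inr (Or.inr (by push_cast; linarith))⟩
    have d1 := (Nat.floor_lt h1.le).2 h1'
    have d2 := (Nat.floor_lt h2.le).2 h2'
    rcases lt_or_gt_of_ne c3 with h | h
    · exact ⟨((⌊x.1⌋₊, ⌊x.2⌋₊), true), ⟨d1, d2⟩, ⟨c2, h, b1⟩⟩
    · exact ⟨((⌊x.1⌋₊, ⌊x.2⌋₊), false), ⟨d1, d2⟩, ⟨c1, h, b2⟩⟩
  · rintro ⟨⟨⟨i, j⟩, b⟩, ⟨hi, hj⟩, h⟩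
    simp only at hi hj
    have hi0 : (0 : ℝ) ≤ i := i.cast_nonneg
    have hj0 : (0 : ℝ) ≤ j := j.cast_nonneg
    have hi1 : (i : ℝ) + 1 ≤ n := by exact_mod_cast hi
    have hj1 : (j : ℝ) + 1 ≤ n := by exact_mod_cast hj
    cases b
    · obtain ⟨h1, h2, h3⟩ : x ∈ upperInterior i j := h
      refine ⟨⟨?_, ?_⟩, ?_, ?_⟩ <;> linarith
    · obtain ⟨h1, h2, h3⟩ : x ∈ lowerInterior i j := h
      refine ⟨⟨?_, ?_⟩, ?_, ?_⟩ <;> linarith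

/-- A function that is constant on each open triangle is integrated by summation. -/
theorem setIntegral_domain_of_const (ω : ℝ) {n : ℕ} (hn : n ≠ 0) {F : ℝ × ℝ → ℝ}
    (c : (ℕ × ℕ) × Bool → ℝ)
    (hF : ∀ k ∈ triangleIndices n, ∀ p ∈ openTriangle ω n k, F p = c k) :
    ∫ p in domain ω, F p = ∑ k ∈ triangleIndices n, 2 / (n : ℝ) ^ 2 * c k := by
  have hmeas := fun k => (isOpen_openTriangle ω n k).measurableSet
  rw [setIntegral_congr_set (domain_ae_eq ω hn), integral_biUnion_finset _ (fun k _ => hmeas k)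
    (fun k _ l _ hkl => pairwise_disjoint_openTriangle ω n hkl)]
  · refine Finset.sum_congr rfl fun k hk => ?_
    rw [setIntegral_congr_fun (hmeas k) (hF k hk), setIntegral_const, smul_eq_mul,
      measureReal_def, volume_openTriangle ω hn, ENNReal.toReal_ofReal (by positivity)]
  · intro k hk
    refine (integrableOn_const (C := c k) ?_).congr_fun (fun p hp => (hF k hk p hp).symm) (hmeas k)
    rw [volume_openTriangle ω hn]
    exact ENNReal.ofReal_ne_top

/-- The `x`-difference quotient on the lower half of a cell, up to scaling, for `ω = π/4`. -/
def lowerDiff (f : ℕ × ℕ → ℝ) (q : ℕ × ℕ) : ℝ :=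
  2 * f (q.1 + 1, q.2) - f q - f (q.1 + 1, q.2 + 1)

/-- The `x`-difference quotient on the upper half of a cell, up to scaling, for `ω = π/4`. -/
def upperDiff (f : ℕ × ℕ → ℝ) (q : ℕ × ℕ) : ℝ :=
  2 * f (q.1, q.2 + 1) - f q - f (q.1 + 1, q.2 + 1)

/-- The difference along the diagonal of a cell: up to scaling the `y`-difference quotient on both
halves of the cell, for `ω = π/4`. -/
def diagDiff (f : ℕ × ℕ → ℝ) (q : ℕ × ℕ) : ℝ :=
  f (q.1 + 1, q.2 + 1) - f q

/-- The energy form for `ω = π/4` as a bilinear form of the nodal values. -/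
noncomputable def gridEnergy (ε : ℝ) (n : ℕ) : (ℕ × ℕ → ℝ) →ₗ[ℝ] (ℕ × ℕ → ℝ) →ₗ[ℝ] ℝ :=
  LinearMap.mk₂ ℝ (fun f g => ∑ q ∈ Finset.range n ×ˢ Finset.range n,
      1 / 4 * (lowerDiff f q * lowerDiff g q + upperDiff f q * upperDiff g q +
        2 * ε * (diagDiff f q * diagDiff g q)))
    (fun f f' g => by
      rw [← Finset.sum_add_distrib]
      refine Finset.sum_congr rfl fun q _ => ?_
      simp only [lowerDiff, upperDiff, diagDiff, Pi.add_apply]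
      ring)
    (fun c f g => by
      rw [Finset.smul_sum]
      refine Finset.sum_congr rfl fun q _ => ?_
      simp only [lowerDiff, upperDiff, diagDiff, Pi.smul_apply, smul_eq_mul]
      ring)
    (fun f g g' => by
      rw [← Finset.sum_add_distrib]
      refine Finset.sum_congr rfl fun q _ => ?_
      simp only [lowerDiff, upperDiff, diagDiff, Pi.add_apply]
      ring)
    (fun c f g => by
      rw [Finset.smul_sum]
      refine Finset.sum_congr rfl fun q _ => ?_
      simp only [lowerDiff, upperDiff, diagDiff, Pi.smul_apply, smul_eq_mul]
      ring)

theorem gridEnergy_apply (ε : ℝ) (n : ℕ) (f g : ℕ × ℕ → ℝ) :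
    gridEnergy ε n f g = ∑ q ∈ Finset.range n ×ˢ Finset.range n,
      1 / 4 * (lowerDiff f q * lowerDiff g q + upperDiff f q * upperDiff g q +
        2 * ε * (diagDiff f q * diagDiff g q)) := rfl

theorem fderiv_of_eqOn_open {v : Fun} {s : Set (ℝ × ℝ)} (hs : IsOpen s) {a b c : ℝ}
    (h : ∀ p ∈ s, v p = a * p.1 + b * p.2 + c) {p : ℝ × ℝ} (hp : p ∈ s) :
    dx v p = a ∧ dy v p = b := by
  have hd : HasFDerivAt (fun p : ℝ × ℝ => a * p.1 + b * p.2 + c)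
      (a • ContinuousLinearMap.fst ℝ ℝ ℝ + b • ContinuousLinearMap.snd ℝ ℝ ℝ) p :=
    ((hasFDerivAt_fst.const_mul a).add (hasFDerivAt_snd.const_mul b)).add_const c
  have he : v =ᶠ[nhds p] fun p : ℝ × ℝ => a * p.1 + b * p.2 + c :=
    Filter.eventually_of_mem (hs.mem_nhds hp) h
  rw [dx, dy, (hd.congr_of_eventuallyEq he).fderiv]
  simp

theorem derivs_lowerInterior {n : ℕ} (hn : n ≠ 0) {v : Fun} (hv : v ∈ femSpace (Real.pi / 4) n)
    {i j : ℕ} (hi : i < n) (hj : j < n) {p : ℝ × ℝ}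
    (hp : p ∈ gridCoord (Real.pi / 4) n ⁻¹' lowerInterior i j) :
    dx v p = n / 2 * (√2 / 2) * lowerDiff (nodalValues (Real.pi / 4) n v) (i, j) ∧
    dy v p = n / 2 * (√2 / 2) * diagDiff (nodalValues (Real.pi / 4) n v) (i, j) := by
  set V := nodalValues (Real.pi / 4) n v
  refine fderiv_of_eqOn_open ((isOpen_lowerInterior i j).preimage (continuous_gridCoord _ n))
    (c := V (i, j) + (n / 2 - i) * (V (i + 1, j) - V (i, j)) +
      (n / 2 - j) * (V (i + 1, j + 1) - V (i + 1, j))) (fun p hp => ?_) hp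
  rw [eq_on_lowerCell hn hv hi hj (lowerInterior_subset i j hp)]
  simp only [gridCoord, Real.cos_pi_div_four, Real.sin_pi_div_four, lowerDiff, diagDiff]
  ring

theorem derivs_upperInterior {n : ℕ} (hn : n ≠ 0) {v : Fun} (hv : v ∈ femSpace (Real.pi / 4) n)
    {i j : ℕ} (hi : i < n) (hj : j < n) {p : ℝ × ℝ}
    (hp : p ∈ gridCoord (Real.pi / 4) n ⁻¹' upperInterior i j) :
    dx v p = n / 2 * (√2 / 2) * -upperDiff (nodalValues (Real.pi / 4) n v) (i, j) ∧
    dy v p = n / 2 * (√2 / 2) * diagDiff (nodalValues (Real.pi / 4) n v) (i, j) := by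
  set V := nodalValues (Real.pi / 4) n v
  refine fderiv_of_eqOn_open ((isOpen_upperInterior i j).preimage (continuous_gridCoord _ n))
    (c := V (i, j) + (n / 2 - i) * (V (i + 1, j + 1) - V (i, j + 1)) +
      (n / 2 - j) * (V (i, j + 1) - V (i, j))) (fun p hp => ?_) hp
  rw [eq_on_upperCell hn hv hi hj (upperInterior_subset i j hp)]
  simp only [gridCoord, Real.cos_pi_div_four, Real.sin_pi_div_four, upperDiff, diagDiff]
  ring

/-- On the mesh rotated by `π/4` the energy form is a second-difference form of the nodal values
that does not depend on the mesh size. -/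
theorem energyForm_eq_gridEnergy (ε : ℝ) {n : ℕ} (hn : n ≠ 0) {u v : Fun}
    (hu : u ∈ femSpace (Real.pi / 4) n) (hv : v ∈ femSpace (Real.pi / 4) n) :
    energyForm (Real.pi / 4) ε u v =
      gridEnergy ε n (nodalValues (Real.pi / 4) n u) (nodalValues (Real.pi / 4) n v) := by
  have hn' : (n : ℝ) ≠ 0 := Nat.cast_ne_zero.mpr hn
  have h2 : √2 ^ 2 = 2 := Real.sq_sqrt (by norm_num)
  set U := nodalValues (Real.pi / 4) n u
  set V := nodalValues (Real.pi / 4) n v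
  rw [energyForm, setIntegral_domain_of_const (Real.pi / 4) hn (fun k => (n : ℝ) ^ 2 / 8 *
    ((if k.2 then lowerDiff U k.1 * lowerDiff V k.1 else upperDiff U k.1 * upperDiff V k.1) +
      ε * (diagDiff U k.1 * diagDiff V k.1)))]
  · rw [triangleIndices, Finset.sum_product, gridEnergy_apply]
    refine Finset.sum_congr rfl fun q _ => ?_
    simp only [Fintype.sum_bool, if_true, Bool.false_eq_true, if_false]
    field_simp
    ring
  · rintro ⟨⟨i, j⟩, b⟩ hk p hp
    simp only [triangleIndices, Finset.mem_product, Finset.mem_range, Finset.mem_univ,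
      and_true] at hk
    cases b
    · obtain ⟨e1, e2⟩ := derivs_upperInterior hn hu hk.1 hk.2 hp
      obtain ⟨e3, e4⟩ := derivs_upperInterior hn hv hk.1 hk.2 hp
      rw [e1, e2, e3, e4]
      simp only [Bool.false_eq_true, if_false]
      linear_combination (n : ℝ) ^ 2 / 16 * (upperDiff U (i, j) * upperDiff V (i, j) +
        ε * (diagDiff U (i, j) * diagDiff V (i, j))) * h2
    · obtain ⟨e1, e2⟩ := derivs_lowerInterior hn hu hk.1 hk.2 hp
      obtain ⟨e3, e4⟩ := derivs_lowerInterior hn hv hk.1 hk.2 hp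
      rw [e1, e2, e3, e4]
      simp only [if_true]
      linear_combination (n : ℝ) ^ 2 / 16 * (lowerDiff U (i, j) * lowerDiff V (i, j) +
        ε * (diagDiff U (i, j) * diagDiff V (i, j))) * h2

/-! ### Bounds for the grid forms -/

theorem gridEnergy_comm (ε : ℝ) (n : ℕ) (f g : ℕ × ℕ → ℝ) :
    gridEnergy ε n f g = gridEnergy ε n g f := by
  simp only [gridEnergy_apply]
  exact Finset.sum_congr rfl fun q _ => by ring

theorem gridEnergy_self_nonneg {ε : ℝ} (hε : 0 ≤ ε) (n : ℕ) (f : ℕ × ℕ → ℝ) :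
    0 ≤ gridEnergy ε n f f := by
  rw [gridEnergy_apply]
  refine Finset.sum_nonneg fun q _ => ?_
  have h1 := mul_self_nonneg (lowerDiff f q)
  have h2 := mul_self_nonneg (upperDiff f q)
  have h3 := mul_nonneg hε (mul_self_nonneg (diagDiff f q))
  linarith

/-- The grid energy is definite for `ε > 0`, because the differences along the diagonals determine
a grid function with zero boundary values. -/
theorem eq_zero_of_gridEnergy_self {ε : ℝ} (hε : 0 < ε) {n : ℕ} {f : ℕ × ℕ → ℝ}
    (hf : ∀ q, q ∉ interiorNodes n → f q = 0) (h : gridEnergy ε n f f = 0) : f = 0 := by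
  have hterm : ∀ q ∈ Finset.range n ×ˢ Finset.range n, diagDiff f q = 0 := by
    intro q hq
    rw [gridEnergy_apply, Finset.sum_eq_zero_iff_of_nonneg] at h
    · have h0 := h q hq
      have h1 := mul_self_nonneg (lowerDiff f q)
      have h2 := mul_self_nonneg (upperDiff f q)
      have h3 := mul_nonneg hε.le (mul_self_nonneg (diagDiff f q))
      have h4 : ε * (diagDiff f q * diagDiff f q) = 0 := by linarith
      exact mul_self_eq_zero.1 ((mul_eq_zero.1 h4).resolve_left hε.ne')
    · intro q _
      have h1 := mul_self_nonneg (lowerDiff f q)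
      have h2 := mul_self_nonneg (upperDiff f q)
      have h3 := mul_nonneg hε.le (mul_self_nonneg (diagDiff f q))
      linarith
  have hall : ∀ i j, f (i, j) = 0 := by
    intro i
    induction i with
    | zero => exact fun j => hf _ (by simp [interiorNodes])
    | succ i ih =>
      intro j
      by_cases hq : (i + 1, j) ∈ interiorNodes n
      · obtain ⟨⟨-, h1⟩, h2, h3⟩ : (0 < i + 1 ∧ i + 1 < n) ∧ 0 < j ∧ j < n := by
          simpa [interiorNodes] using hq
        obtain ⟨j, rfl⟩ := Nat.exists_eq_succ_of_ne_zero h2.ne'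
        have hd := hterm (i, j) (by simp; omega)
        rw [diagDiff, ih j, sub_zero] at hd
        exact hd
      · exact hf _ hq
  exact funext fun q => hall q.1 q.2

/-- Shifting a grid function with zero boundary values by at most one cell keeps its support
within the index square of the cells. -/
theorem sum_shift {n : ℕ} {F : ℕ × ℕ → ℝ} (hF : ∀ q, q ∉ interiorNodes n → F q = 0) (s : ℕ × ℕ)
    (hs : s.1 ≤ 1 ∧ s.2 ≤ 1) :
    ∑ q ∈ Finset.range n ×ˢ Finset.range n, F (q.1 + s.1, q.2 + s.2) =
      ∑ q ∈ interiorNodes n, F q := by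
  have himg := Finset.sum_image (f := F) (s := Finset.range n ×ˢ Finset.range n)
    (g := fun q : ℕ × ℕ => (q.1 + s.1, q.2 + s.2)) (fun q _ r _ h => by
      simp only [Prod.mk.injEq] at h
      exact Prod.ext (by omega) (by omega))
  rw [← himg]
  refine (Finset.sum_subset (fun q hq => ?_) fun q _ hq => hF q hq).symm
  simp only [interiorNodes, Finset.mem_product, Finset.mem_Ioo] at hq
  rw [Finset.mem_image]
  refine ⟨(q.1 - s.1, q.2 - s.2), ?_, Prod.ext ?_ ?_⟩
  · simp only [Finset.mem_product, Finset.mem_range]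
    omega
  · simp only
    omega
  · simp only
    omega

/-- The energy of a nodal basis function. The shifted copies of its nodal values that occur in the
difference quotients have disjoint supports, so that no mixed terms arise. -/
theorem gridEnergy_single (ε : ℝ) {n : ℕ} {p : ℕ × ℕ} (hp : p ∈ interiorNodes n) :
    gridEnergy ε n (Pi.single p 1) (Pi.single p 1) = 3 + ε := by
  set F : ℕ × ℕ → ℝ := Pi.single p 1 with hFdef
  have hF : ∀ q, q ∉ interiorNodes n → F q = 0 := fun q hq =>
    Pi.single_eq_of_ne (fun h => hq (by rw [h]; exact hp)) _
  have hsq : ∀ q, F q * F q = F q := fun q => by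
    rw [hFdef, Pi.single_apply]
    split_ifs <;> norm_num
  have hmul : ∀ q r, q ≠ r → F q * F r = 0 := fun q r hqr => by
    by_cases h : q = p
    · rw [hFdef, Pi.single_eq_of_ne (fun h' => hqr (h.trans h'.symm)), mul_zero]
    · rw [hFdef, Pi.single_eq_of_ne h, zero_mul]
  have hsum : ∑ q ∈ interiorNodes n, F q = 1 := by
    simp only [hFdef, Pi.single_apply, Finset.sum_ite_eq', hp, if_true]
  have h00 := (sum_shift hF (0, 0) (by simp)).trans hsum
  have h10 := (sum_shift hF (1, 0) (by simp)).trans hsum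
  have h01 := (sum_shift hF (0, 1) (by simp)).trans hsum
  have h11 := (sum_shift hF (1, 1) (by simp)).trans hsum
  simp only [add_zero] at h00 h10 h01
  have hterm : ∀ q : ℕ × ℕ, 1 / 4 * (lowerDiff F q * lowerDiff F q +
      upperDiff F q * upperDiff F q + 2 * ε * (diagDiff F q * diagDiff F q)) =
      1 / 4 * (4 * F (q.1 + 1, q.2) + 4 * F (q.1, q.2 + 1) +
        (2 + 2 * ε) * F (q.1, q.2) + (2 + 2 * ε) * F (q.1 + 1, q.2 + 1)) := by
    rintro ⟨i, j⟩
    have a1 := hmul (i + 1, j) (i, j) (by simp)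
    have a2 := hmul (i + 1, j) (i + 1, j + 1) (by simp)
    have a3 := hmul (i, j) (i + 1, j + 1) (by simp)
    have a4 := hmul (i, j + 1) (i, j) (by simp)
    have a5 := hmul (i, j + 1) (i + 1, j + 1) (by simp)
    have b1 := hsq (i + 1, j)
    have b2 := hsq (i, j)
    have b3 := hsq (i + 1, j + 1)
    have b4 := hsq (i, j + 1)
    simp only [lowerDiff, upperDiff, diagDiff]
    linear_combination b1 + b4 + (1 / 2 + ε / 2) * (b2 + b3) - a1 - a2 + (1 - ε) * a3 - a4 - a5
  rw [gridEnergy_apply, Finset.sum_congr rfl fun q _ => hterm q, ← Finset.mul_sum]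
  simp only [Finset.sum_add_distrib, ← Finset.mul_sum, h00, h10, h01, h11]
  ring

/-- The bilinear form obtained from `gridEnergy` by giving all coefficients of the difference
quotients a positive sign. -/
noncomputable def gridEnergyAbs (ε : ℝ) (n : ℕ) : (ℕ × ℕ → ℝ) →ₗ[ℝ] (ℕ × ℕ → ℝ) →ₗ[ℝ] ℝ :=
  LinearMap.mk₂ ℝ (fun f g => ∑ q ∈ Finset.range n ×ˢ Finset.range n,
      1 / 4 * ((2 * f (q.1 + 1, q.2) + f q + f (q.1 + 1, q.2 + 1)) *
          (2 * g (q.1 + 1, q.2) + g q + g (q.1 + 1, q.2 + 1)) +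
        (2 * f (q.1, q.2 + 1) + f q + f (q.1 + 1, q.2 + 1)) *
          (2 * g (q.1, q.2 + 1) + g q + g (q.1 + 1, q.2 + 1)) +
        2 * ε * ((f (q.1 + 1, q.2 + 1) + f q) * (g (q.1 + 1, q.2 + 1) + g q))))
    (fun f f' g => by
      rw [← Finset.sum_add_distrib]
      refine Finset.sum_congr rfl fun q _ => ?_
      simp only [Pi.add_apply]
      ring)
    (fun c f g => by
      rw [Finset.smul_sum]
      refine Finset.sum_congr rfl fun q _ => ?_
      simp only [Pi.smul_apply, smul_eq_mul]
      ring)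
    (fun f g g' => by
      rw [← Finset.sum_add_distrib]
      refine Finset.sum_congr rfl fun q _ => ?_
      simp only [Pi.add_apply]
      ring)
    (fun c f g => by
      rw [Finset.smul_sum]
      refine Finset.sum_congr rfl fun q _ => ?_
      simp only [Pi.smul_apply, smul_eq_mul]
      ring)

theorem gridEnergyAbs_apply (ε : ℝ) (n : ℕ) (f g : ℕ × ℕ → ℝ) :
    gridEnergyAbs ε n f g = ∑ q ∈ Finset.range n ×ˢ Finset.range n,
      1 / 4 * ((2 * f (q.1 + 1, q.2) + f q + f (q.1 + 1, q.2 + 1)) *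
          (2 * g (q.1 + 1, q.2) + g q + g (q.1 + 1, q.2 + 1)) +
        (2 * f (q.1, q.2 + 1) + f q + f (q.1 + 1, q.2 + 1)) *
          (2 * g (q.1, q.2 + 1) + g q + g (q.1 + 1, q.2 + 1)) +
        2 * ε * ((f (q.1 + 1, q.2 + 1) + f q) * (g (q.1 + 1, q.2 + 1) + g q))) := rfl

theorem gridEnergyAbs_comm (ε : ℝ) (n : ℕ) (f g : ℕ × ℕ → ℝ) :
    gridEnergyAbs ε n f g = gridEnergyAbs ε n g f := by
  simp only [gridEnergyAbs_apply]
  exact Finset.sum_congr rfl fun q _ => by ring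

theorem gridEnergyAbs_self_nonneg {ε : ℝ} (hε : 0 ≤ ε) (n : ℕ) (f : ℕ × ℕ → ℝ) :
    0 ≤ gridEnergyAbs ε n f f := by
  rw [gridEnergyAbs_apply]
  refine Finset.sum_nonneg fun q _ => mul_nonneg (by norm_num) ?_
  exact add_nonneg (add_nonneg (mul_self_nonneg _) (mul_self_nonneg _))
    (mul_nonneg (by positivity) (mul_self_nonneg _))

theorem gridEnergyAbs_nonneg {ε : ℝ} (hε : 0 ≤ ε) (n : ℕ) {f g : ℕ × ℕ → ℝ} (hf : 0 ≤ f)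
    (hg : 0 ≤ g) : 0 ≤ gridEnergyAbs ε n f g := by
  rw [gridEnergyAbs_apply]
  refine Finset.sum_nonneg fun q _ => ?_
  have hf' : ∀ r, 0 ≤ f r := hf
  have hg' : ∀ r, 0 ≤ g r := hg
  have f1 := hf' q
  have f2 := hf' (q.1 + 1, q.2)
  have f3 := hf' (q.1, q.2 + 1)
  have f4 := hf' (q.1 + 1, q.2 + 1)
  have g1 := hg' q
  have g2 := hg' (q.1 + 1, q.2)
  have g3 := hg' (q.1, q.2 + 1)
  have g4 := hg' (q.1 + 1, q.2 + 1)
  positivity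

theorem abs_gridEnergy_le {ε : ℝ} (hε : 0 ≤ ε) (n : ℕ) (f g : ℕ × ℕ → ℝ) :
    |gridEnergy ε n f g| ≤ gridEnergyAbs ε n |f| |g| := by
  have hdiff : ∀ a b c : ℝ, |2 * a - b - c| ≤ 2 * |a| + |b| + |c| := fun a b c => by
    have h1 := abs_sub (2 * a - b) c
    have h2 := abs_sub (2 * a) b
    rw [abs_mul, abs_two] at h2
    linarith
  have hprod : ∀ {x y X Y : ℝ}, |x| ≤ X → |y| ≤ Y → |x * y| ≤ X * Y := fun hx hy => by
    rw [abs_mul]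
    exact mul_le_mul hx hy (abs_nonneg _) ((abs_nonneg _).trans hx)
  rw [gridEnergy_apply, gridEnergyAbs_apply]
  refine (Finset.abs_sum_le_sum_abs _ _).trans (Finset.sum_le_sum fun q _ => ?_)
  rw [abs_mul, abs_of_nonneg (by norm_num : (0 : ℝ) ≤ 1 / 4)]
  refine mul_le_mul_of_nonneg_left ((abs_add_three _ _ _).trans (add_le_add (add_le_add ?_ ?_) ?_))
    (by norm_num)
  · exact hprod (hdiff _ _ _) (hdiff _ _ _)
  · exact hprod (hdiff _ _ _) (hdiff _ _ _)
  · rw [abs_mul, abs_of_nonneg (by positivity : 0 ≤ 2 * ε)]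
    exact mul_le_mul_of_nonneg_left (hprod (abs_sub _ _) (abs_sub _ _)) (by positivity)

/-- The inner product of the values at the interior vertices. -/
noncomputable def gridDot (n : ℕ) : (ℕ × ℕ → ℝ) →ₗ[ℝ] (ℕ × ℕ → ℝ) →ₗ[ℝ] ℝ :=
  LinearMap.mk₂ ℝ (fun f g => ∑ q ∈ interiorNodes n, f q * g q)
    (fun f f' g => by simp only [Pi.add_apply, add_mul, Finset.sum_add_distrib])
    (fun c f g => by simp only [Pi.smul_apply, smul_eq_mul, Finset.mul_sum, mul_assoc])
    (fun f g g' => by simp only [Pi.add_apply, mul_add, Finset.sum_add_distrib])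
    (fun c f g => by simp only [Pi.smul_apply, smul_eq_mul, Finset.mul_sum, mul_left_comm])

theorem gridDot_apply (n : ℕ) (f g : ℕ × ℕ → ℝ) :
    gridDot n f g = ∑ q ∈ interiorNodes n, f q * g q := rfl

theorem gridDot_comm (n : ℕ) (f g : ℕ × ℕ → ℝ) : gridDot n f g = gridDot n g f := by
  simp only [gridDot_apply, mul_comm]

theorem gridDot_self_nonneg (n : ℕ) (f : ℕ × ℕ → ℝ) : 0 ≤ gridDot n f f :=
  Finset.sum_nonneg fun _ _ => mul_self_nonneg _

theorem eq_zero_of_gridDot_self {n : ℕ} {f : ℕ × ℕ → ℝ}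
    (hf : ∀ q, q ∉ interiorNodes n → f q = 0) (h : gridDot n f f = 0) : f = 0 := by
  rw [gridDot_apply, Finset.sum_eq_zero_iff_of_nonneg fun _ _ => mul_self_nonneg _] at h
  funext q
  by_cases hq : q ∈ interiorNodes n
  · exact mul_self_eq_zero.1 (h q hq)
  · exact hf q hq

theorem gridDot_abs (n : ℕ) (f : ℕ × ℕ → ℝ) : gridDot n |f| |f| = gridDot n f f := by
  simp only [gridDot_apply, Pi.abs_apply, abs_mul_abs_self]

/-- The form with absolute values is bounded by the sum of squares, since every basis function
interacts with boundedly many others. -/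
theorem gridEnergyAbs_self_le {ε : ℝ} (hε : 0 ≤ ε) {n : ℕ} {f : ℕ × ℕ → ℝ}
    (hf : ∀ q, q ∉ interiorNodes n → f q = 0) :
    gridEnergyAbs ε n f f ≤ (8 + 2 * ε) * gridDot n f f := by
  have hF : ∀ q, q ∉ interiorNodes n → (fun q => f q * f q) q = 0 := fun q hq => by
    simp only [hf q hq, mul_zero]
  have h00 := sum_shift hF (0, 0) (by simp)
  have h10 := sum_shift hF (1, 0) (by simp)
  have h01 := sum_shift hF (0, 1) (by simp)
  have h11 := sum_shift hF (1, 1) (by simp)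
  simp only [add_zero, ← gridDot_apply] at h00 h10 h01 h11
  have hterm : ∀ a b c d : ℝ,
      1 / 4 * ((2 * b + a + d) * (2 * b + a + d) + (2 * c + a + d) * (2 * c + a + d) +
        2 * ε * ((d + a) * (d + a))) ≤
      2 * (b * b) + 2 * (c * c) + (2 + ε) * (a * a) + (2 + ε) * (d * d) := fun a b c d => by
    nlinarith [sq_nonneg (b - a), sq_nonneg (b - d), sq_nonneg (a - d), sq_nonneg (c - a),
      sq_nonneg (c - d), mul_nonneg hε (sq_nonneg (a - d))]
  rw [gridEnergyAbs_apply]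
  refine (Finset.sum_le_sum fun q _ => hterm (f q) (f (q.1 + 1, q.2)) (f (q.1, q.2 + 1))
    (f (q.1 + 1, q.2 + 1))).trans (le_of_eq ?_)
  simp only [Finset.sum_add_distrib, ← Finset.mul_sum]
  rw [h10, h01, h11, h00]
  ring

/-! ### The interpolation error -/

theorem sum_range_two_mul (N : ℕ) (F : ℕ → ℝ) :
    ∑ i ∈ Finset.range (2 * N), F i = ∑ I ∈ Finset.range N, (F (2 * I) + F (2 * I + 1)) := by
  induction N with
  | zero => simp
  | succ N ih => rw [mul_add, mul_one, Finset.sum_range_succ, Finset.sum_range_succ, ih,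
      Finset.sum_range_succ, add_assoc]

theorem sum_blocks (N : ℕ) (F : ℕ × ℕ → ℝ) :
    ∑ q ∈ Finset.range (2 * N) ×ˢ Finset.range (2 * N), F q =
      ∑ q ∈ Finset.range N ×ˢ Finset.range N, (F (2 * q.1, 2 * q.2) + F (2 * q.1 + 1, 2 * q.2) +
        F (2 * q.1, 2 * q.2 + 1) + F (2 * q.1 + 1, 2 * q.2 + 1)) := by
  rw [Finset.sum_product, sum_range_two_mul, Finset.sum_product]
  refine Finset.sum_congr rfl fun I _ => ?_
  rw [sum_range_two_mul, sum_range_two_mul, ← Finset.sum_add_distrib]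
  exact Finset.sum_congr rfl fun J _ => by ring

/-- The error of nodal interpolation on the coarse mesh is bounded by the energy, uniformly in
`ε ≥ 0`: the second differences along all three edge directions are combinations of the scaled
`x`-derivatives on the triangles of one block of `2 × 2` cells. -/
theorem exists_coarse_approximation {N : ℕ} (hN : N ≠ 0) {ε : ℝ} (hε : 0 ≤ ε) {v : Fun}
    (hv : v ∈ femSpace (Real.pi / 4) (2 * N)) :
    ∃ w ∈ femSpace (Real.pi / 4) N,
      gridDot (2 * N) (nodalValues (Real.pi / 4) (2 * N) (v - w))
        (nodalValues (Real.pi / 4) (2 * N) (v - w)) ≤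
      9 * gridEnergy ε (2 * N) (nodalValues (Real.pi / 4) (2 * N) v)
        (nodalValues (Real.pi / 4) (2 * N) v) := by
  have h2N : 2 * N ≠ 0 := by omega
  set V := nodalValues (Real.pi / 4) (2 * N) v with hV
  have hV0 : ∀ q, q ∉ interiorNodes (2 * N) → V q = 0 := fun q hq => nodalValues_eq_zero h2N hv hq
  obtain ⟨w, hw, hwV⟩ := exists_nodalValues_eq (Real.pi / 4) hN (fun q => V (2 * q.1, 2 * q.2))
    (fun q hq => hV0 _ fun h => hq (by
      simp only [interiorNodes, Finset.mem_product, Finset.mem_Ioo] at h ⊢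
      omega))
  refine ⟨w, hw, ?_⟩
  set E := nodalValues (Real.pi / 4) (2 * N) (v - w) with hE
  have hE0 : ∀ q, q ∉ interiorNodes (2 * N) → E q * E q = 0 := fun q hq => by
    rw [show E q = 0 from nodalValues_eq_zero h2N
      (Submodule.sub_mem _ hv (femSpace_le_refine _ hN hw)) hq, mul_zero]
  have hEsub : ∀ q, E q = V q - nodalValues (Real.pi / 4) (2 * N) w q := fun q => by
    rw [hE, map_sub, Pi.sub_apply]
  have hwq : ∀ I J, nodalValues (Real.pi / 4) N w (I, J) = V (2 * I, 2 * J) := fun I J =>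
    congrFun hwV (I, J)
  -- boundary vertices are added to the error sum, so that it splits into the `2 × 2` blocks
  have hsum := sum_shift hE0 (0, 0) (by simp)
  simp only [add_zero, Prod.mk.eta] at hsum
  rw [gridDot_apply, ← hsum, gridEnergy_apply, sum_blocks, sum_blocks, Finset.mul_sum]
  refine Finset.sum_le_sum fun q hq => ?_
  obtain ⟨I, J⟩ := q
  obtain ⟨hI, hJ⟩ : I < N ∧ J < N := by simpa using hq
  have e00 : E (2 * I, 2 * J) = 0 := by
    rw [hEsub, nodalValues_refine_even, hwq, sub_self]
  have e10 : E (2 * I + 1, 2 * J) = 1 / 2 * (lowerDiff V (2 * I, 2 * J) -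
      (lowerDiff V (2 * I + 1, 2 * J) - upperDiff V (2 * I + 1, 2 * J)) / 2) := by
    rw [hEsub, nodalValues_refine_horizontal hw hI hJ, hwq, hwq]
    simp only [lowerDiff, upperDiff, mul_add, mul_one, add_assoc, one_add_one_eq_two]
    ring
  have e01 : E (2 * I, 2 * J + 1) = 1 / 2 * (upperDiff V (2 * I, 2 * J) -
      (upperDiff V (2 * I, 2 * J + 1) - lowerDiff V (2 * I, 2 * J + 1)) / 2) := by
    rw [hEsub, nodalValues_refine_vertical hw hI hJ, hwq, hwq]
    simp only [lowerDiff, upperDiff, mul_add, mul_one, add_assoc, one_add_one_eq_two]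
    ring
  have e11 : E (2 * I + 1, 2 * J + 1) = 1 / 2 * (2 * upperDiff V (2 * I + 1, 2 * J) +
      lowerDiff V (2 * I, 2 * J) + lowerDiff V (2 * I + 1, 2 * J + 1)) := by
    rw [hEsub, nodalValues_refine_diagonal hw hI hJ, hwq, hwq]
    simp only [lowerDiff, upperDiff, mul_add, mul_one, add_assoc, one_add_one_eq_two]
    ring
  have hb : ∀ a b c : ℝ, (1 / 2 * (a - (b - c) / 2)) * (1 / 2 * (a - (b - c) / 2)) ≤
      3 / 8 * (a * a + b * b + c * c) := fun a b c => by
    nlinarith [sq_nonneg (2 * b + a), sq_nonneg (2 * c - a), sq_nonneg (b + c)]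
  have hb' : ∀ a b c : ℝ, (1 / 2 * (2 * a + b + c)) * (1 / 2 * (2 * a + b + c)) ≤
      3 / 2 * (a * a + b * b + c * c) := fun a b c => by
    nlinarith [sq_nonneg (a - 2 * b), sq_nonneg (a - 2 * c), sq_nonneg (b - c)]
  have hpos : ∀ q, 0 ≤ ε * (diagDiff V q * diagDiff V q) := fun q =>
    mul_nonneg hε (mul_self_nonneg _)
  have hL : ∀ q, 0 ≤ lowerDiff V q * lowerDiff V q := fun q => mul_self_nonneg _
  have hU : ∀ q, 0 ≤ upperDiff V q * upperDiff V q := fun q => mul_self_nonneg _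
  have b10 := hb (lowerDiff V (2 * I, 2 * J)) (lowerDiff V (2 * I + 1, 2 * J))
    (upperDiff V (2 * I + 1, 2 * J))
  have b01 := hb (upperDiff V (2 * I, 2 * J)) (upperDiff V (2 * I, 2 * J + 1))
    (lowerDiff V (2 * I, 2 * J + 1))
  have b11 := hb' (upperDiff V (2 * I + 1, 2 * J)) (lowerDiff V (2 * I, 2 * J))
    (lowerDiff V (2 * I + 1, 2 * J + 1))
  simp only [e00, e10, e01, e11]
  linarith [hpos (2 * I, 2 * J), hpos (2 * I + 1, 2 * J), hpos (2 * I, 2 * J + 1),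
    hpos (2 * I + 1, 2 * J + 1), hL (2 * I, 2 * J), hL (2 * I + 1, 2 * J), hL (2 * I, 2 * J + 1),
    hL (2 * I + 1, 2 * J + 1), hU (2 * I, 2 * J), hU (2 * I + 1, 2 * J), hU (2 * I, 2 * J + 1),
    hU (2 * I + 1, 2 * J + 1)]

/-! ### Orthogonal projections -/

theorem orthProj_spec {B : Fun → Fun → ℝ} {W : Submodule ℝ Fun} {v : Fun}
    (h : ∃ p : Fun, p ∈ W ∧ ∀ q ∈ W, B (v - p) q = 0) :
    orthProj B W v ∈ W ∧ ∀ q ∈ W, B (v - orthProj B W v) q = 0 :=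
  Classical.epsilon_spec h

/-- Orthogonal projections onto a finite-dimensional space exist as soon as the form is definite
on that space, which makes it nondegenerate there. -/
theorem exists_orthogonal {E : Type*} [AddCommGroup E] [Module ℝ E] (B : E →ₗ[ℝ] E →ₗ[ℝ] ℝ)
    (W : Submodule ℝ E) [FiniteDimensional ℝ W] (hB : ∀ w ∈ W, B w w = 0 → w = 0) (v : E) :
    ∃ p ∈ W, ∀ q ∈ W, B (v - p) q = 0 := by
  let Φ : W →ₗ[ℝ] Module.Dual ℝ W := B.compl₁₂ W.subtype W.subtype
  have hinj : Function.Injective Φ := by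
    rw [injective_iff_map_eq_zero]
    intro w hw
    exact Subtype.ext (hB w w.2 (LinearMap.congr_fun hw w))
  have hsurj := (LinearMap.injective_iff_surjective_of_finrank_eq_finrank
    Subspace.dual_finrank_eq.symm).1 hinj
  obtain ⟨p, hp⟩ := hsurj ((B v).comp W.subtype)
  refine ⟨p, p.2, fun q hq => ?_⟩
  have := LinearMap.congr_fun hp ⟨q, hq⟩
  rw [map_sub, LinearMap.sub_apply, sub_eq_zero]
  exact this.symm

theorem nodalValues_pointSpace {ω : ℝ} {n : ℕ} (hn : n ≠ 0) {p : ℕ × ℕ} {v : Fun}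
    (hv : v ∈ pointSpace ω n p) :
    nodalValues ω n v = nodalValues ω n v p • Pi.single p 1 := by
  funext q
  rw [Pi.smul_apply, Pi.single_apply, smul_eq_mul]
  split_ifs with h
  · rw [h, mul_one]
  · rw [mul_zero]
    by_cases hq : q ∈ interiorNodes n
    · exact hv.2 q hq h
    · exact nodalValues_eq_zero hn hv.1 hq

theorem nodalBasis_mem_pointSpace {ω : ℝ} {n : ℕ} (hn : n ≠ 0) {p : ℕ × ℕ}
    (hp : p ∈ interiorNodes n) : nodalBasis ω n p ∈ pointSpace ω n p := by
  refine ⟨nodalBasis_mem hn hp, fun q _ hqp => ?_⟩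
  exact (congrFun (nodalValues_nodalBasis ω hn p) q).trans (Pi.single_eq_of_ne hqp _)

/-- The decomposition of `v` into nodal basis functions is unique, so that the star norm is a
multiple of the Euclidean norm of the nodal values. -/
theorem starNormSq_eq (ε : ℝ) {n : ℕ} (hn : n ≠ 0) {v : Fun}
    (hv : v ∈ femSpace (Real.pi / 4) n) :
    starNormSq (Real.pi / 4) ε n v = (3 + ε) *
      gridDot n (nodalValues (Real.pi / 4) n v) (nodalValues (Real.pi / 4) n v) := by
  set V := nodalValues (Real.pi / 4) n v with hV
  have henergy : ∀ w : ℕ × ℕ → Fun,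
      (∀ p ∈ interiorNodes n, w p ∈ pointSpace (Real.pi / 4) n p) →
      ∑ p ∈ interiorNodes n, w p = v →
      ∑ p ∈ interiorNodes n, energyForm (Real.pi / 4) ε (w p) (w p) = (3 + ε) * gridDot n V V := by
    intro w hw hsum
    rw [gridDot_apply, Finset.mul_sum]
    refine Finset.sum_congr rfl fun p hp => ?_
    have hval : nodalValues (Real.pi / 4) n (w p) p = V p := by
      rw [hV, ← hsum, map_sum, Finset.sum_apply, Finset.sum_eq_single_of_mem p hp]
      intro q hq hqp
      rw [nodalValues_pointSpace hn (hw q hq), Pi.smul_apply, Pi.single_eq_of_ne hqp.symm,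
        smul_zero]
    rw [energyForm_eq_gridEnergy ε hn (hw p hp).1 (hw p hp).1,
      nodalValues_pointSpace hn (hw p hp), hval, map_smul, map_smul, LinearMap.smul_apply,
      gridEnergy_single ε hp, smul_eq_mul, smul_eq_mul]
    ring
  have hset : {s : ℝ | ∃ w : ℕ × ℕ → Fun,
      (∀ p ∈ interiorNodes n, w p ∈ pointSpace (Real.pi / 4) n p) ∧
      ∑ p ∈ interiorNodes n, w p = v ∧
      s = ∑ p ∈ interiorNodes n, energyForm (Real.pi / 4) ε (w p) (w p)} =
      {(3 + ε) * gridDot n V V} := by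
    apply Set.Subset.antisymm
    · rintro s ⟨w, hw, hsum, rfl⟩
      exact henergy w hw hsum
    · rintro s rfl
      have hw : ∀ p ∈ interiorNodes n,
          V p • nodalBasis (Real.pi / 4) n p ∈ pointSpace (Real.pi / 4) n p := fun p hp =>
        Submodule.smul_mem _ _ (nodalBasis_mem_pointSpace hn hp)
      exact ⟨_, hw, eq_sum_nodalBasis hn hv, (henergy _ hw (eq_sum_nodalBasis hn hv)).symm⟩
  rw [starNormSq, hset, csInf_singleton]

theorem starInner_eq (ε : ℝ) {n : ℕ} (hn : n ≠ 0) {u v : Fun}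
    (hu : u ∈ femSpace (Real.pi / 4) n) (hv : v ∈ femSpace (Real.pi / 4) n) :
    starInner (Real.pi / 4) ε n u v = (3 + ε) *
      gridDot n (nodalValues (Real.pi / 4) n u) (nodalValues (Real.pi / 4) n v) := by
  rw [starInner, starNormSq_eq ε hn (Submodule.add_mem _ hu hv),
    starNormSq_eq ε hn (Submodule.sub_mem _ hu hv)]
  simp only [map_add, map_sub, LinearMap.add_apply, LinearMap.sub_apply]
  rw [gridDot_comm n (nodalValues (Real.pi / 4) n v) (nodalValues (Real.pi / 4) n u)]
  ring

theorem starProj_coarse_spec {ε : ℝ} {N : ℕ} (hN : N ≠ 0) {v : Fun}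
    (hv : v ∈ femSpace (Real.pi / 4) (2 * N)) :
    orthProj (starInner (Real.pi / 4) ε (2 * N)) (femSpace (Real.pi / 4) N) v ∈
        femSpace (Real.pi / 4) N ∧
      ∀ q ∈ femSpace (Real.pi / 4) N, starInner (Real.pi / 4) ε (2 * N)
        (v - orthProj (starInner (Real.pi / 4) ε (2 * N)) (femSpace (Real.pi / 4) N) v) q = 0 := by
  have h2N : 2 * N ≠ 0 := by omega
  have hle := femSpace_le_refine (Real.pi / 4) hN
  have := finiteDimensional_femSpace (Real.pi / 4) hN
  obtain ⟨p, hp, h⟩ := exists_orthogonal ((gridDot (2 * N)).compl₁₂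
    (nodalValues (Real.pi / 4) (2 * N)) (nodalValues (Real.pi / 4) (2 * N)))
    (femSpace (Real.pi / 4) N) (fun w hw h0 => eq_zero_of_nodalValues h2N (hle hw)
      (eq_zero_of_gridDot_self (fun q hq => nodalValues_eq_zero h2N (hle hw) hq) h0)) v
  refine orthProj_spec ⟨p, hp, fun q hq => ?_⟩
  rw [starInner_eq ε h2N (Submodule.sub_mem _ hv (hle hp)) (hle hq)]
  exact mul_eq_zero_of_right _ (h q hq)

theorem energyProj_coarse_spec {ε : ℝ} (hε : 0 < ε) {N : ℕ} (hN : N ≠ 0) {v : Fun}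
    (hv : v ∈ femSpace (Real.pi / 4) (2 * N)) :
    orthProj (energyForm (Real.pi / 4) ε) (femSpace (Real.pi / 4) N) v ∈
        femSpace (Real.pi / 4) N ∧
      ∀ q ∈ femSpace (Real.pi / 4) N, energyForm (Real.pi / 4) ε
        (v - orthProj (energyForm (Real.pi / 4) ε) (femSpace (Real.pi / 4) N) v) q = 0 := by
  have h2N : 2 * N ≠ 0 := by omega
  have hle := femSpace_le_refine (Real.pi / 4) hN
  have := finiteDimensional_femSpace (Real.pi / 4) hN
  obtain ⟨p, hp, h⟩ := exists_orthogonal ((gridEnergy ε (2 * N)).compl₁₂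
    (nodalValues (Real.pi / 4) (2 * N)) (nodalValues (Real.pi / 4) (2 * N)))
    (femSpace (Real.pi / 4) N) (fun w hw h0 => eq_zero_of_nodalValues h2N (hle hw)
      (eq_zero_of_gridEnergy_self hε (fun q hq => nodalValues_eq_zero h2N (hle hw) hq) h0)) v
  refine orthProj_spec ⟨p, hp, fun q hq => ?_⟩
  rw [energyForm_eq_gridEnergy ε h2N (Submodule.sub_mem _ hv (hle hp)) (hle hq)]
  exact h q hq

/-- The correction at the vertex `p` is a multiple of the nodal basis function, and its coefficient
is the residual divided by the energy `3 + ε` of that function. -/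
theorem energyProj_point_spec {ε : ℝ} (hε : 0 < ε) {n : ℕ} (hn : n ≠ 0) {p : ℕ × ℕ}
    (hp : p ∈ interiorNodes n) {v : Fun} (hv : v ∈ femSpace (Real.pi / 4) n) :
    ∃ c : ℝ, orthProj (energyForm (Real.pi / 4) ε) (pointSpace (Real.pi / 4) n p) v ∈
        femSpace (Real.pi / 4) n ∧
      nodalValues (Real.pi / 4) n
        (orthProj (energyForm (Real.pi / 4) ε) (pointSpace (Real.pi / 4) n p) v) =
          c • Pi.single p 1 ∧
      gridEnergy ε n (nodalValues (Real.pi / 4) n v) (Pi.single p 1) = (3 + ε) * c := by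
  have hne : 3 + ε ≠ 0 := by positivity
  set V := nodalValues (Real.pi / 4) n v with hV
  have hspec := orthProj_spec (B := energyForm (Real.pi / 4) ε) (v := v)
    (W := pointSpace (Real.pi / 4) n p) ⟨(gridEnergy ε n V (Pi.single p 1) / (3 + ε)) •
      nodalBasis (Real.pi / 4) n p, Submodule.smul_mem _ _ (nodalBasis_mem_pointSpace hn hp),
      fun q hq => by
        rw [energyForm_eq_gridEnergy ε hn (Submodule.sub_mem _ hv
          (Submodule.smul_mem _ _ (nodalBasis_mem hn hp))) hq.1, nodalValues_pointSpace hn hq]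
        simp only [map_sub, map_smul, ← hV, nodalValues_nodalBasis _ hn, LinearMap.sub_apply,
          LinearMap.smul_apply, gridEnergy_single ε hp, smul_eq_mul, div_mul_cancel₀ _ hne,
          sub_self, mul_zero]⟩
  set r := orthProj (energyForm (Real.pi / 4) ε) (pointSpace (Real.pi / 4) n p) v
  have hr := nodalValues_pointSpace hn hspec.1
  refine ⟨nodalValues (Real.pi / 4) n r p, hspec.1.1, hr, ?_⟩
  have h0 := hspec.2 _ (nodalBasis_mem_pointSpace hn hp)
  rw [energyForm_eq_gridEnergy ε hn (Submodule.sub_mem _ hv hspec.1.1) (nodalBasis_mem hn hp),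
    nodalValues_nodalBasis _ hn, map_sub, hr, map_sub, map_smul, LinearMap.sub_apply,
    LinearMap.smul_apply, gridEnergy_single ε hp, smul_eq_mul, sub_eq_zero] at h0
  rw [h0, mul_comm]

/-! ### The Gauss-Seidel sweep -/

/-- With `c p` the coefficient of the correction at the vertex `p`, the sweep reduces the energy by
`(3 + ε) ∑ c²`. The residual of `u` at a vertex is the sum of the correction there and the
interactions with the corrections made before it, whence the second bound. -/
theorem gsSweep_spec {ε : ℝ} (hε : 0 < ε) {n : ℕ} (hn : n ≠ 0) (l : List (ℕ × ℕ)) (hl : l.Nodup)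
    (hint : ∀ p ∈ l, p ∈ interiorNodes n) : ∀ u ∈ femSpace (Real.pi / 4) n,
    gsSweep (Real.pi / 4) ε n l u ∈ femSpace (Real.pi / 4) n ∧
    ∃ c : ℕ × ℕ → ℝ, (∀ q, q ∉ l → c q = 0) ∧
      gridEnergy ε n (nodalValues (Real.pi / 4) n (gsSweep (Real.pi / 4) ε n l u))
          (nodalValues (Real.pi / 4) n (gsSweep (Real.pi / 4) ε n l u)) =
        gridEnergy ε n (nodalValues (Real.pi / 4) n u) (nodalValues (Real.pi / 4) n u) -
          (3 + ε) * gridDot n c c ∧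
      ∀ e : ℕ × ℕ → ℝ, (∀ q, q ∉ l → e q = 0) →
        |gridEnergy ε n (nodalValues (Real.pi / 4) n u) e| ≤ gridEnergyAbs ε n |e| |c| := by
  induction l with
  | nil =>
    intro u hu
    refine ⟨hu, 0, fun _ _ => rfl, by simp [gsSweep], fun e he => ?_⟩
    have : e = 0 := funext fun q => he q List.not_mem_nil
    simp [this]
  | cons p l ih =>
    intro u hu
    obtain ⟨hpl, hl'⟩ := List.nodup_cons.1 hl
    have hp := hint p List.mem_cons_self
    obtain ⟨γ, hrmem, hr, hγ⟩ := energyProj_point_spec hε hn hp hu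
    set r := orthProj (energyForm (Real.pi / 4) ε) (pointSpace (Real.pi / 4) n p) u with hrdef
    set U := nodalValues (Real.pi / 4) n u with hU
    have hstep : gsSweep (Real.pi / 4) ε n (p :: l) u = gsSweep (Real.pi / 4) ε n l (u - r) := rfl
    obtain ⟨hmem, c, hc, henergy, hbound⟩ := ih hl'
      (fun q hq => hint q (List.mem_cons_of_mem p hq)) (u - r) (Submodule.sub_mem _ hu hrmem)
    set φ : ℕ × ℕ → ℝ := Pi.single p 1 with hφ
    have hφp : φ p = 1 := Pi.single_eq_same p 1
    have hφq : ∀ q, q ≠ p → φ q = 0 := fun q hq => Pi.single_eq_of_ne hq 1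
    have hφφ : gridEnergy ε n φ φ = 3 + ε := gridEnergy_single ε hp
    have hφnn : 0 ≤ φ := Pi.single_nonneg.2 zero_le_one
    have hφabs : |φ| = φ := abs_of_nonneg hφnn
    have hcp : c p = 0 := hc p hpl
    -- the supports are disjoint
    have habs : ∀ (a : ℝ) (f : ℕ × ℕ → ℝ), f p = 0 → |f + a • φ| = |f| + |a| • φ := by
      intro a f hf
      funext q
      simp only [Pi.abs_apply, Pi.add_apply, Pi.smul_apply, smul_eq_mul]
      by_cases hq : q = p
      · rw [hq, hφp, hf]
        simp
      · rw [hφq q hq]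
        simp
    rw [map_sub, hr, ← hU] at henergy hbound
    rw [hstep]
    refine ⟨hmem, c + γ • φ, fun q hq => ?_, ?_, fun e he => ?_⟩
    · rw [List.mem_cons, not_or] at hq
      rw [Pi.add_apply, Pi.smul_apply, hc q hq.2, hφq q hq.1, smul_zero, add_zero]
    · have hdot : gridDot n c φ = 0 := Finset.sum_eq_zero fun q _ => by
        by_cases hq : q = p
        · rw [hq, hcp, zero_mul]
        · rw [hφq q hq, mul_zero]
      have hdotφ : gridDot n φ φ = 1 := by
        rw [gridDot_apply, Finset.sum_eq_single_of_mem p hp fun q _ hq => by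
          rw [hφq q hq, mul_zero], hφp, mul_one]
      rw [henergy]
      simp only [map_sub, map_add, map_smul, LinearMap.sub_apply, LinearMap.add_apply,
        LinearMap.smul_apply, smul_eq_mul, gridEnergy_comm ε n φ U, gridDot_comm n φ c, hγ, hφφ,
        hdot, hdotφ]
      ring
    · set e' : ℕ × ℕ → ℝ := e - e p • φ with he'
      have he'p : e' p = 0 := by
        rw [he', Pi.sub_apply, Pi.smul_apply, hφp, smul_eq_mul, mul_one, sub_self]
      have he'l : ∀ q, q ∉ l → e' q = 0 := fun q hq => by
        by_cases hqp : q = p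
        · rw [hqp, he'p]
        · rw [he', Pi.sub_apply, Pi.smul_apply, hφq q hqp, smul_zero, sub_zero]
          exact he q (by simp [hqp, hq])
      have hee : e = e' + e p • φ := (sub_add_cancel _ _).symm
      have h1 := hbound e' he'l
      have h2 := abs_gridEnergy_le hε.le n φ e'
      have h3 := abs_gridEnergy_le hε.le n φ φ
      rw [hφabs] at h2 h3
      rw [hφφ, abs_of_pos (by positivity)] at h3
      have h4 : 0 ≤ gridEnergyAbs ε n φ |c| := gridEnergyAbs_nonneg hε.le n hφnn (abs_nonneg c)
      have hL : gridEnergy ε n U e = gridEnergy ε n (U - γ • φ) e' + γ * gridEnergy ε n φ e' +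
          e p * ((3 + ε) * γ) := by
        conv_lhs => rw [hee]
        simp only [map_sub, map_add, map_smul, LinearMap.sub_apply, LinearMap.smul_apply,
          smul_eq_mul, hγ]
        ring
      have hR : gridEnergyAbs ε n |e| |c + γ • φ| = gridEnergyAbs ε n |e'| |c| +
          |γ| * gridEnergyAbs ε n φ |e'| + |e p| * gridEnergyAbs ε n φ |c| +
          |e p| * |γ| * gridEnergyAbs ε n φ φ := by
        rw [habs γ c hcp, show |e| = |e'| + |e p| • φ by rw [← habs _ _ he'p, ← hee]]
        simp only [map_add, map_smul, LinearMap.add_apply, LinearMap.smul_apply, smul_eq_mul,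
          gridEnergyAbs_comm ε n |e'| φ]
        ring
      rw [hL, hR]
      refine (abs_add_three _ _ _).trans ?_
      rw [abs_mul, abs_mul, abs_mul, abs_of_pos (by positivity : 0 < 3 + ε)]
      have k1 := mul_le_mul_of_nonneg_left h2 (abs_nonneg γ)
      have k2 := mul_le_mul_of_nonneg_left h3 (mul_nonneg (abs_nonneg (e p)) (abs_nonneg γ))
      have k3 := mul_nonneg (abs_nonneg (e p)) h4
      linarith

/-! ### The stability constant and the two-level method -/

theorem energyForm_self_pos {ε : ℝ} (hε : 0 < ε) {n : ℕ} (hn : n ≠ 0) {v : Fun}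
    (hv : v ∈ femSpace (Real.pi / 4) n) (hv0 : v ≠ 0) : 0 < energyForm (Real.pi / 4) ε v v := by
  rw [energyForm_eq_gridEnergy ε hn hv hv]
  refine lt_of_le_of_ne (gridEnergy_self_nonneg hε.le n _) fun h => hv0 ?_
  exact eq_zero_of_nodalValues hn hv
    (eq_zero_of_gridEnergy_self hε (fun q hq => nodalValues_eq_zero hn hv hq) h.symm)

theorem stabilityK_le {ε : ℝ} (hε : 0 < ε) {N : ℕ} (hN : N ≠ 0) :
    stabilityK (Real.pi / 4) ε N ≤ ((9 * (3 + ε) : ℝ) : EReal) := by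
  have h2N : 2 * N ≠ 0 := by omega
  have hle := femSpace_le_refine (Real.pi / 4) hN
  refine iSup₂_le fun v ⟨hv, hv0⟩ => EReal.coe_le_coe_iff.2 ?_
  rw [div_le_iff₀ (energyForm_self_pos hε h2N hv hv0), energyForm_eq_gridEnergy ε h2N hv hv]
  obtain ⟨hπ, hort⟩ := starProj_coarse_spec (ε := ε) hN hv
  set π := orthProj (starInner (Real.pi / 4) ε (2 * N)) (femSpace (Real.pi / 4) N) v
  obtain ⟨w, hw, happrox⟩ := exists_coarse_approximation hN hε.le hv
  have hvπ := Submodule.sub_mem _ hv (hle hπ)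
  have h0 := hort (π - w) (Submodule.sub_mem _ hπ hw)
  rw [starInner_eq ε h2N hvπ (hle (Submodule.sub_mem _ hπ hw))] at h0
  have h0' := (mul_eq_zero.1 h0).resolve_left (by positivity)
  rw [starNormSq_eq ε h2N hvπ]
  have hsplit : v - w = (v - π) + (π - w) := by abel
  rw [hsplit, map_add] at happrox
  have hnn := gridDot_self_nonneg (2 * N) (nodalValues (Real.pi / 4) (2 * N) (π - w))
  have hcomm := gridDot_comm (2 * N) (nodalValues (Real.pi / 4) (2 * N) (π - w))
    (nodalValues (Real.pi / 4) (2 * N) (v - π))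
  simp only [map_add, LinearMap.add_apply, hcomm, h0'] at happrox
  have h1 := mul_le_mul_of_nonneg_left happrox (by positivity : 0 ≤ 3 + ε)
  have h2 := mul_nonneg (by positivity : 0 ≤ 3 + ε) hnn
  linarith

/-- On the energy-orthogonal complement of the coarse space a Gauss-Seidel sweep reduces the energy
by a fixed factor. -/
theorem energy_gsSweep_le {ε : ℝ} (hε : 0 < ε) {N : ℕ} (hN : N ≠ 0) {order : List (ℕ × ℕ)}
    (horder : IsNodeOrdering (2 * N) order) {v : Fun} (hv : v ∈ femSpace (Real.pi / 4) (2 * N))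
    (hort : ∀ q ∈ femSpace (Real.pi / 4) N, energyForm (Real.pi / 4) ε v q = 0) :
    energyForm (Real.pi / 4) ε (gsSweep (Real.pi / 4) ε (2 * N) order v)
        (gsSweep (Real.pi / 4) ε (2 * N) order v) ≤
      (1 - 1 / (3 * (8 + 2 * ε) ^ 2)) * energyForm (Real.pi / 4) ε v v := by
  have h2N : 2 * N ≠ 0 := by omega
  have hle := femSpace_le_refine (Real.pi / 4) hN
  obtain ⟨hmem, c, hc, henergy, hbound⟩ := gsSweep_spec hε h2N order horder.1
    (fun p hp => (horder.2 p).1 hp) v hv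
  obtain ⟨w, hw, happrox⟩ := exists_coarse_approximation hN hε.le hv
  have hvw := Submodule.sub_mem _ hv (hle hw)
  have h0 := hort w hw
  rw [energyForm_eq_gridEnergy ε h2N hv (hle hw)] at h0
  rw [energyForm_eq_gridEnergy ε h2N hmem hmem, energyForm_eq_gridEnergy ε h2N hv hv, henergy]
  set V := nodalValues (Real.pi / 4) (2 * N) v
  set e := nodalValues (Real.pi / 4) (2 * N) (v - w) with he
  have he0 : ∀ q, q ∉ interiorNodes (2 * N) → e q = 0 := fun q hq =>
    nodalValues_eq_zero h2N hvw hq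
  have hb := hbound e (fun q hq => he0 q (mt (horder.2 q).2 hq))
  have hVe : gridEnergy ε (2 * N) V e = gridEnergy ε (2 * N) V V := by
    rw [he, map_sub, map_sub, h0, sub_zero]
  rw [hVe, abs_of_nonneg (gridEnergy_self_nonneg hε.le _ V)] at hb
  set a := gridEnergy ε (2 * N) V V
  set R := 8 + 2 * ε with hR
  have hRpos : 0 < R := by positivity
  have hee : gridEnergyAbs ε (2 * N) |e| |e| ≤ R * gridDot (2 * N) e e := by
    rw [← gridDot_abs]
    exact gridEnergyAbs_self_le hε.le fun q hq => by rw [Pi.abs_apply, he0 q hq, abs_zero]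
  have hcc : gridEnergyAbs ε (2 * N) |c| |c| ≤ R * gridDot (2 * N) c c := by
    rw [← gridDot_abs]
    exact gridEnergyAbs_self_le hε.le fun q hq => by
      rw [Pi.abs_apply, hc q (mt (horder.2 q).1 hq), abs_zero]
  -- the weight `9 R` balances the two terms of Young's inequality
  have hyoung := gridEnergyAbs_self_nonneg hε.le (2 * N) (|e| - (9 * R) • |c|)
  simp only [map_sub, map_smul, LinearMap.sub_apply, LinearMap.smul_apply, smul_eq_mul,
    gridEnergyAbs_comm ε (2 * N) |c| |e|] at hyoung
  set X := gridEnergyAbs ε (2 * N) |e| |c|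
  have hS := gridDot_self_nonneg (2 * N) c
  set S := gridDot (2 * N) c c
  have hee' : gridEnergyAbs ε (2 * N) |e| |e| ≤ R * (9 * a) :=
    hee.trans (mul_le_mul_of_nonneg_left happrox hRpos.le)
  have hcc' := mul_le_mul_of_nonneg_left hcc (by positivity : 0 ≤ (9 * R) * (9 * R))
  have hmain : R * (9 * a) ≤ R * (9 * (9 * R ^ 2 * S)) := by
    have := mul_le_mul_of_nonneg_left hb (by positivity : 0 ≤ 2 * (9 * R))
    nlinarith
  have ha : a ≤ 9 * R ^ 2 * S := by
    have := le_of_mul_le_mul_left hmain hRpos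
    linarith
  have hdiv : 1 / (3 * R ^ 2) * a ≤ 3 * S := by
    rw [div_mul_eq_mul_div, one_mul, div_le_iff₀ (by positivity)]
    linarith
  have hεS := mul_nonneg hε.le hS
  linarith

theorem twoLevelErrorNormSq_le {ε : ℝ} (hε : 0 < ε) {N : ℕ} (hN : N ≠ 0)
    {order : List (ℕ × ℕ)} (horder : IsNodeOrdering (2 * N) order) :
    twoLevelErrorNormSq (Real.pi / 4) ε N order ≤
      ((1 - 1 / (3 * (8 + 2 * ε) ^ 2) : ℝ) : EReal) := by
  have h2N : 2 * N ≠ 0 := by omega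
  have hle := femSpace_le_refine (Real.pi / 4) hN
  refine iSup₂_le fun u ⟨hu, hu0⟩ => EReal.coe_le_coe_iff.2 ?_
  rw [div_le_iff₀ (energyForm_self_pos hε h2N hu hu0), twoLevelError]
  obtain ⟨hp, hort⟩ := energyProj_coarse_spec hε hN hu
  set p := orthProj (energyForm (Real.pi / 4) ε) (femSpace (Real.pi / 4) N) u
  have hv := Submodule.sub_mem _ hu (hle hp)
  refine (energy_gsSweep_le hε hN horder hv hort).trans (mul_le_mul_of_nonneg_left ?_ ?_)
  · have h0 := hort p hp
    rw [energyForm_eq_gridEnergy ε h2N hv (hle hp)] at h0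
    rw [energyForm_eq_gridEnergy ε h2N hv hv, energyForm_eq_gridEnergy ε h2N hu hu]
    have hnn := gridEnergy_self_nonneg hε.le (2 * N) (nodalValues (Real.pi / 4) (2 * N) p)
    have hsplit : nodalValues (Real.pi / 4) (2 * N) u =
        nodalValues (Real.pi / 4) (2 * N) (u - p) + nodalValues (Real.pi / 4) (2 * N) p := by
      rw [← map_add, sub_add_cancel]
    have hcomm := gridEnergy_comm ε (2 * N) (nodalValues (Real.pi / 4) (2 * N) p)
      (nodalValues (Real.pi / 4) (2 * N) (u - p))
    rw [hsplit]
    simp only [map_add, LinearMap.add_apply, hcomm, h0]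
    linarith
  · rw [sub_nonneg, div_le_one (by positivity)]
    nlinarith

end AnisoFEM

theorem mainTheorem3 :
    ∀ ε₀ : ℝ, 0 < ε₀ → ∃ C : ℝ, 0 < C ∧
      ∀ (N : ℕ), 1 ≤ N → ∀ ε : ℝ, 0 < ε → ε ≤ ε₀ →
        AnisoFEM.stabilityK (Real.pi / 4) ε N ≤ ((C : ℝ) : EReal) ∧
        ∀ order : List (ℕ × ℕ), AnisoFEM.IsNodeOrdering (2 * N) order →
          AnisoFEM.twoLevelErrorNormSq (Real.pi / 4) ε N order ≤ ((1 - 1 / C : ℝ) : EReal) := by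
  intro ε₀ hε₀
  refine ⟨3 * (8 + 2 * ε₀) ^ 2, by positivity, fun N hN ε hε hle => ⟨?_, fun order horder => ?_⟩⟩
  · refine (AnisoFEM.stabilityK_le hε (by omega)).trans (EReal.coe_le_coe_iff.2 ?_)
    nlinarith
  · refine (AnisoFEM.twoLevelErrorNormSq_le hε (by omega) horder).trans
      (EReal.coe_le_coe_iff.2 ?_)
    have : 1 / (3 * (8 + 2 * ε₀) ^ 2) ≤ 1 / (3 * (8 + 2 * ε) ^ 2) := by gcongr
    linarith
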